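/- **Theorem.** For an $N\times N$ sign matrix $S\in\{\pm1\}^{N\times N}$ let $\operatorname{sign-rank}(S)$ be the minimum rank over $\mathbb{R}$ of a real matrix $M$ with $\operatorname{sign}(M_{i,j})=S_{i,j}$ for all $i,j$. There are a universal constant $c>0$ and a (deterministic) algorithm, running in time polynomial in $N$ (on a random access machine with logarithmic cost), which, given any $N\ge 2$ and any $N\times N$ sign matrix $S$, outputs a natural number $A$ such that $$\operatorname{sign-rank}(S)\;\le\; A\;\le\; c\cdot\frac{N}{\log N}\cdot\operatorname{sign-rank}(S).$$ -/

import Mathlib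

/-- The sign rank of a sign matrix `S` (entries in `ℤˣ = {1, -1}`): the least rank over `ℝ` of a
real matrix `M` with `sign (M i j) = S i j` for all `i`, `j`. As `Real.sign 0 = 0`, such an `M`
has no zero entry. -/
noncomputable def signRank {m n : Type*} [Fintype m] [Fintype n] (S : Matrix m n ℤˣ) : ℕ :=
  sInf {r | ∃ M : Matrix m n ℝ, (∀ i j, Real.sign (M i j) = ((S i j : ℤ) : ℝ)) ∧ M.rank = r}

namespace RAM

/-! A random access machine with the logarithmic cost criterion, programmed by structured
programs. The store has scalar registers and arrays of unbounded length, all holding natural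
numbers; a given program mentions only finitely many registers and arrays. -/

/-- The store of the machine: register `x` holds `reg x`, and cell `i` of array `a` holds
`arr a i`. -/
structure Store where
  reg : ℕ → ℕ
  arr : ℕ → ℕ → ℕ

/-- Arithmetic terms. The argument of `lit` is a constant of the program, that of `reg` the name
of a register, and `get a e` reads the cell of the array `a` whose address is the value of `e`. -/
inductive Term where
  | lit (n : ℕ)
  | reg (x : ℕ)
  | get (a : ℕ) (e : Term)
  | add (e f : Term)
  | sub (e f : Term)
  | mul (e f : Term)

/-- The value of a term. Subtraction is the truncated subtraction of natural numbers. -/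
def Term.val (s : Store) : Term → ℕ
  | lit n => n
  | reg x => s.reg x
  | get a e => s.arr a (e.val s)
  | add e f => e.val s + f.val s
  | sub e f => e.val s - f.val s
  | mul e f => e.val s * f.val s

/-- The logarithmic cost of evaluating a term: every constant, register access, memory access and
arithmetic operation costs one plus the number of binary digits of the number it yields. The
address of a memory access is itself the value of a term, hence charged as well. -/
def Term.cost (s : Store) : Term → ℕ
  | lit n => 1 + Nat.size n
  | reg x => 1 + Nat.size (s.reg x)
  | get a e => e.cost s + (1 + Nat.size (s.arr a (e.val s)))
  | add e f => e.cost s + f.cost s + (1 + Nat.size (e.val s + f.val s))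
  | sub e f => e.cost s + f.cost s + (1 + Nat.size (e.val s - f.val s))
  | mul e f => e.cost s + f.cost s + (1 + Nat.size (e.val s * f.val s))

/-- Programs: no operation, assignment to a register, assignment to the array cell with address
`e`, composition, branching on `e ≠ 0`, and iteration as long as `e ≠ 0`. -/
inductive Prog where
  | skip
  | assign (x : ℕ) (e : Term)
  | put (a : ℕ) (e f : Term)
  | seq (p q : Prog)
  | ite (e : Term) (p q : Prog)
  | loop (e : Term) (p : Prog)

/-- `Exec p s t s'`: started in the store `s`, the program `p` halts after time `t` in the
store `s'`. -/
inductive Exec : Prog → Store → ℕ → Store → Prop where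
  | skip (s : Store) : Exec .skip s 1 s
  | assign (x : ℕ) (e : Term) (s : Store) :
      Exec (.assign x e) s (1 + e.cost s) ⟨Function.update s.reg x (e.val s), s.arr⟩
  | put (a : ℕ) (e f : Term) (s : Store) :
      Exec (.put a e f) s (1 + e.cost s + f.cost s)
        ⟨s.reg, Function.update s.arr a (Function.update (s.arr a) (e.val s) (f.val s))⟩
  | seq {p q : Prog} {s s' s'' : Store} {t t' : ℕ} :
      Exec p s t s' → Exec q s' t' s'' → Exec (.seq p q) s (t + t') s''
  | ite_true {e : Term} {p q : Prog} {s s' : Store} {t : ℕ} :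
      e.val s ≠ 0 → Exec p s t s' → Exec (.ite e p q) s (1 + e.cost s + t) s'
  | ite_false {e : Term} {p q : Prog} {s s' : Store} {t : ℕ} :
      e.val s = 0 → Exec q s t s' → Exec (.ite e p q) s (1 + e.cost s + t) s'
  | loop_true {e : Term} {p : Prog} {s s' s'' : Store} {t t' : ℕ} :
      e.val s ≠ 0 → Exec p s t s' → Exec (.loop e p) s' t' s'' →
        Exec (.loop e p) s (1 + e.cost s + t + t') s''
  | loop_false {e : Term} {p : Prog} {s : Store} :
      e.val s = 0 → Exec (.loop e p) s (1 + e.cost s) s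

/-- Execution is deterministic: running time and final store are determined by the program and
the initial store. -/
theorem Exec.unique {p : Prog} {s s₁ s₂ : Store} {t₁ t₂ : ℕ} (h₁ : Exec p s t₁ s₁)
    (h₂ : Exec p s t₂ s₂) : t₁ = t₂ ∧ s₁ = s₂ := by
  induction h₁ generalizing t₂ s₂ with
  | skip | assign | put => cases h₂; exact ⟨rfl, rfl⟩
  | seq _ _ ih ih' =>
    cases h₂ with
    | seq a b =>
      obtain ⟨rfl, rfl⟩ := ih a
      obtain ⟨rfl, rfl⟩ := ih' b
      exact ⟨rfl, rfl⟩
  | ite_true h _ ih =>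
    cases h₂ with
    | ite_true _ a => obtain ⟨rfl, rfl⟩ := ih a; exact ⟨rfl, rfl⟩
    | ite_false h' _ => exact absurd h' h
  | ite_false h _ ih =>
    cases h₂ with
    | ite_true h' _ => exact absurd h h'
    | ite_false _ a => obtain ⟨rfl, rfl⟩ := ih a; exact ⟨rfl, rfl⟩
  | loop_true h _ _ ih ih' =>
    cases h₂ with
    | loop_true _ a b =>
      obtain ⟨rfl, rfl⟩ := ih a
      obtain ⟨rfl, rfl⟩ := ih' b
      exact ⟨rfl, rfl⟩
    | loop_false h' => exact absurd h' h
  | loop_false h =>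
    cases h₂ with
    | loop_true h' _ _ => exact absurd h h'
    | loop_false _ => exact ⟨rfl, rfl⟩

/-- The initial store on input an `N × N` sign matrix `S`: register `0` holds `N`, array `0` holds
the entries of `S` row by row (`1` for the entry `1`, and `0` for the entry `-1`), and
everything else is `0`. -/
def input {N : ℕ} (S : Matrix (Fin N) (Fin N) ℤˣ) : Store where
  reg x := if x = 0 then N else 0
  arr a k :=
    if h : a = 0 ∧ k < N * N then
      if S (Fin.divNat ⟨k, h.2⟩) (Fin.modNat ⟨k, h.2⟩) = 1 then 1 else 0
    else 0

/-- `Outputs p S t A`: on input the sign matrix `S`, the program `p` halts after time `t` with the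
number `A` in register `0`. -/
def Outputs {N : ℕ} (p : Prog) (S : Matrix (Fin N) (Fin N) ℤˣ) (t A : ℕ) : Prop :=
  ∃ s : Store, Exec p (input S) t s ∧ s.reg 0 = A

end RAM

/-!
If the rows of `S` can be ordered such that every column changes its sign at most `K` times, then
interpolating the columns by polynomials of degree at most `K` yields `signRank S ≤ K + 1`. The
algorithm finds such an order through a spanning tree on the rows. It repeatedly picks a closest
pair among the active rows, joins them by an edge and makes one of them inactive; the distance is
the Hamming distance with weighted columns, and the weight of a column is doubled whenever the two
rows joined by an edge differ in it. Inserting every row next to the row it was attached to gives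
an order in which a column changes its sign at most twice as often as along the edges of the tree.

The sets of columns traced by the rows have VC dimension at most `d = signRank S`, because the
columns of a matrix of rank `d` which are shattered by its rows are linearly independent. By
Haussler's packing lemma, among `r` active rows two have distance at most an `O(d / log r)`
fraction of the total weight, so the total weight grows to at most
`N * exp (O(d * ∑ r, 1 / log r)) = N * exp (O(d * N / log N))`. Hence no weight is doubled more
than `O(d * N / log N)` times.
-/

open Finset Polynomial

section SignChanges

variable {α : Type*} [DecidableEq α]

/-- The number of sign changes of a list of signs, for lists over any type: the number of pairs of
adjacent entries that differ. -/
def numChanges : List α → ℕ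
  | [] => 0
  | [_] => 0
  | a :: b :: l => (if a ≠ b then 1 else 0) + numChanges (b :: l)

theorem numChanges_insert_le (l₁ l₂ : List α) (a b : α) :
    numChanges (l₁ ++ a :: b :: l₂) ≤
      numChanges (l₁ ++ a :: l₂) + 2 * (if a ≠ b then 1 else 0) := by
  induction l₁ with
  | nil => cases l₂ <;> simp only [List.nil_append, numChanges] <;> grind
  | cons c l₁ ih =>
    cases l₁ <;> simp only [List.nil_append, List.cons_append, numChanges] at ih ⊢ <;> omega

theorem intUnit_mul_self (u : ℤˣ) : (u : ℝ) * u = 1 := by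
  rcases Int.units_eq_one_or u with rfl | rfl <;> simp

theorem exists_polynomial_sign_change (a b : ℤˣ) :
    ∃ q : ℝ[X], q.natDegree ≤ (if a ≠ b then 1 else 0) ∧
      (∀ x ≤ 0, 0 < (a : ℝ) * b * q.eval x) ∧ ∀ x ≥ 1, 0 < q.eval x := by
  by_cases hab : a = b
  · refine ⟨1, by simp, fun x _ => ?_, fun x _ => by simp⟩
    rcases Int.units_eq_one_or b with rfl | rfl <;> simp [hab]
  · have hneg : (a : ℝ) * b = -1 := by
      rcases Int.units_eq_one_or a with rfl | rfl <;>
        rcases Int.units_eq_one_or b with rfl | rfl <;> simp_all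
    refine ⟨C 2 * X - C 1, ?_, fun x hx => ?_, fun x hx => ?_⟩
    · rw [if_pos hab]
      compute_degree
    · simp only [hneg, eval_sub, eval_mul, eval_C, eval_X]
      linarith
    · simp only [eval_sub, eval_mul, eval_C, eval_X]
      linarith

theorem exists_polynomial_sign_cons (a : ℤˣ) (l : List ℤˣ) :
    ∃ p : ℝ[X], p.natDegree ≤ numChanges (a :: l) ∧ (∀ x ≤ 0, 0 < (a : ℝ) * p.eval x) ∧
      ∀ (i : ℕ) (h : i < l.length), 0 < (l[i] : ℝ) * p.eval ((i : ℝ) + 1) := by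
  induction l generalizing a with
  | nil =>
    refine ⟨C (a : ℝ), by simp, fun x _ => ?_, by simp⟩
    rcases Int.units_eq_one_or a with rfl | rfl <;> simp
  | cons b l ih =>
    obtain ⟨p, hdeg, hp0, hp⟩ := ih b
    obtain ⟨q, hqdeg, hq0, hq1⟩ := exists_polynomial_sign_change a b
    have heval : ∀ x, (p.comp (X - C 1) * q).eval x = p.eval (x - 1) * q.eval x := by simp
    refine ⟨p.comp (X - C 1) * q, ?_, fun x hx => ?_, ?_⟩
    · calc (p.comp (X - C 1) * q).natDegree
          ≤ (p.comp (X - C 1)).natDegree + q.natDegree := natDegree_mul_le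
        _ ≤ p.natDegree * 1 + q.natDegree := by
            gcongr
            exact natDegree_comp_le.trans_eq (by rw [natDegree_X_sub_C])
        _ ≤ numChanges (a :: b :: l) := by
            rw [numChanges]
            omega
    · calc 0 < (b : ℝ) * p.eval (x - 1) * ((a : ℝ) * b * q.eval x) :=
            mul_pos (hp0 _ (by linarith)) (hq0 x hx)
        _ = (a : ℝ) * (p.comp (X - C 1) * q).eval x := by
            rw [heval]
            linear_combination (a : ℝ) * p.eval (x - 1) * q.eval x * intUnit_mul_self b
    · intro i h
      rw [heval, ← mul_assoc, add_sub_cancel_right]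
      refine mul_pos ?_ (hq1 _ (by simp))
      cases i with
      | zero => simpa using hp0 0 le_rfl
      | succ i => simpa using hp i (by simpa using h)

theorem exists_polynomial_sign (l : List ℤˣ) :
    ∃ p : ℝ[X], p.natDegree ≤ numChanges l ∧
      ∀ (i : ℕ) (h : i < l.length), 0 < (l[i] : ℝ) * p.eval (i : ℝ) := by
  cases l with
  | nil => exact ⟨0, by simp, by simp⟩
  | cons a l =>
    obtain ⟨p, hdeg, hp0, hp⟩ := exists_polynomial_sign_cons a l
    refine ⟨p, hdeg, fun i h => ?_⟩
    cases i with
    | zero => simpa using hp0 0 le_rfl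
    | succ i => simpa using hp i (by simpa using h)

end SignChanges

section SignRank

theorem sign_eq_intUnit_iff {x : ℝ} {u : ℤˣ} : x.sign = ((u : ℤ) : ℝ) ↔ 0 < (u : ℝ) * x := by
  rcases lt_trichotomy x 0 with hx | rfl | hx
  · rcases Int.units_eq_one_or u with rfl | rfl <;> norm_num [Real.sign_of_neg hx, hx, hx.le]
  · rcases Int.units_eq_one_or u with rfl | rfl <;> simp
  · rcases Int.units_eq_one_or u with rfl | rfl <;> norm_num [Real.sign_of_pos hx, hx, hx.le]

variable {m n : Type*} {S : Matrix m n ℤˣ}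

section RowTrace

/-- The set system traced by the rows of a sign matrix: row `i` is viewed as the set of columns
in which it has the entry `1`, and is restricted to the columns in `T`. -/
def rowTrace (S : Matrix m n ℤˣ) (T : Finset n) (i : m) : Finset n :=
  {j ∈ T | S i j = 1}

theorem rowTrace_eq_rowTrace_iff {T : Finset n} {i k : m} :
    rowTrace S T i = rowTrace S T k ↔ ∀ j ∈ T, S i j = S k j := by
  rw [rowTrace, rowTrace, Finset.filter_inj']
  refine forall₂_congr fun j _ => ?_
  rcases Int.units_eq_one_or (S i j) with hi | hi <;>
    rcases Int.units_eq_one_or (S k j) with hk | hk <;> simp [hi, hk]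

variable [DecidableEq n]

theorem exists_row_sign_eq_of_shatters {R : Finset m} {T s : Finset n}
    (hs : (R.image (rowTrace S T)).Shatters s) (t : Finset n) :
    ∃ i, ∀ j ∈ s, S i j = 1 ↔ j ∈ t := by
  obtain ⟨v, hv, hsv⟩ := hs.exists_superset
  obtain ⟨i, -, rfl⟩ := mem_image.1 hv
  obtain ⟨u, hu, hsu⟩ := hs (inter_subset_left : s ∩ t ⊆ s)
  obtain ⟨k, -, rfl⟩ := mem_image.1 hu
  refine ⟨k, fun j hj => ?_⟩
  have hjT : j ∈ T := (mem_filter.1 (hsv hj)).1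
  have := Finset.ext_iff.1 hsu j
  simpa [rowTrace, hj, hjT] using this

theorem linearIndependent_col_of_shatters {M : Matrix m n ℝ} (hM : ∀ i j, 0 < (S i j : ℝ) * M i j)
    {R : Finset m} {T s : Finset n} (hs : (R.image (rowTrace S T)).Shatters s) :
    LinearIndependent ℝ fun j : s => M.col j := by
  rw [Fintype.linearIndependent_iff]
  intro g hg
  by_contra! ⟨j₀, hj₀⟩
  obtain ⟨i, hi⟩ := exists_row_sign_eq_of_shatters hs (({j | 0 < g j} : Finset s).map (.subtype _))
  have hSg : ∀ j : s, g j ≠ 0 → 0 < (S i j : ℝ) * g j := fun j hj => by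
    have hij : S i j = 1 ↔ 0 < g j := by simpa using hi j j.2
    rcases hj.lt_or_gt with hneg | hpos
    · have : S i j = -1 := (Int.units_eq_one_or _).resolve_left (mt hij.1 hneg.not_gt)
      simpa [this] using hneg
    · simpa [hij.2 hpos] using hpos
  have hgM : ∀ j : s, g j ≠ 0 → 0 < g j * M i j := fun j hj => by
    have := mul_pos (hSg j hj) (hM i j)
    rwa [mul_mul_mul_comm, intUnit_mul_self, one_mul] at this
  have hsum : 0 < ∑ j : s, g j * M i j :=
    sum_pos' (fun j _ => (eq_or_ne (g j) 0).elim (fun h => by simp [h]) fun h => (hgM j h).le)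
      ⟨j₀, mem_univ _, hgM j₀ hj₀⟩
  exact hsum.ne' (by simpa [Matrix.col_apply] using congrFun hg i)

end RowTrace

variable [Fintype m] [Fintype n]

theorem signRank_le_rank {M : Matrix m n ℝ} (hM : ∀ i j, 0 < (S i j : ℝ) * M i j) :
    signRank S ≤ M.rank :=
  Nat.sInf_le ⟨M, fun i j => sign_eq_intUnit_iff.2 (hM i j), rfl⟩

variable (S)

theorem exists_rank_eq_signRank :
    ∃ M : Matrix m n ℝ, (∀ i j, 0 < (S i j : ℝ) * M i j) ∧ M.rank = signRank S := by
  have hne : {r | ∃ M : Matrix m n ℝ,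
      (∀ i j, (M i j).sign = ((S i j : ℤ) : ℝ)) ∧ M.rank = r}.Nonempty := by
    refine ⟨_, fun i j => (S i j : ℝ), fun i j => sign_eq_intUnit_iff.2 ?_, rfl⟩
    rcases Int.units_eq_one_or (S i j) with h | h <;> simp [h]
  obtain ⟨M, hM, hr⟩ := Nat.sInf_mem hne
  exact ⟨M, fun i j => sign_eq_intUnit_iff.1 (hM i j), hr⟩

theorem signRank_pos [Nonempty m] [Nonempty n] : 0 < signRank S := by
  obtain ⟨M, hM, hr⟩ := exists_rank_eq_signRank S
  obtain ⟨i⟩ := ‹Nonempty m›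
  obtain ⟨j⟩ := ‹Nonempty n›
  let E : Matrix Unit Unit ℝ := M.submatrix (fun _ => i) fun _ => j
  have hE : IsUnit E := by
    rw [Matrix.isUnit_iff_isUnit_det, Matrix.det_unique]
    exact (right_ne_zero_of_mul (hM i j).ne').isUnit
  calc 0 < Fintype.card Unit := Fintype.card_pos
    _ = E.rank := (Matrix.rank_of_isUnit E hE).symm
    _ ≤ M.rank := Matrix.rank_submatrix_le _ _ _
    _ = signRank S := hr

variable {S} in
theorem signRank_le_of_numChanges_le {L : List m} (hL : ∀ i, i ∈ L) {K : ℕ}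
    (hK : ∀ j, numChanges (L.map (S · j)) ≤ K) : signRank S ≤ K + 1 := by
  choose pos hpos hget using fun i => List.mem_iff_getElem.1 (hL i)
  choose p hdeg hp using fun j => exists_polynomial_sign (L.map (S · j))
  let V : Matrix m (Fin (K + 1)) ℝ := .of fun i t => (pos i : ℝ) ^ (t : ℕ)
  let A : Matrix (Fin (K + 1)) n ℝ := .of fun t j => (p j).coeff t
  have hVA : ∀ i j, (V * A) i j = (p j).eval (pos i : ℝ) := fun i j => by
    rw [Matrix.mul_apply, eval_eq_sum_range' (Nat.lt_succ_of_le ((hdeg j).trans (hK j))),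
      sum_range]
    exact sum_congr rfl fun t _ => mul_comm _ _
  have hpos' : ∀ i j, 0 < (S i j : ℝ) * (V * A) i j := fun i j => by
    have := hp j (pos i) (by simpa using hpos i)
    rwa [List.getElem_map, hget, ← hVA] at this
  calc signRank S ≤ (V * A).rank := signRank_le_rank hpos'
    _ ≤ V.rank := Matrix.rank_mul_le_left V A
    _ ≤ K + 1 := by simpa using V.rank_le_card_width

theorem vcDim_image_rowTrace_le_signRank [DecidableEq n] (R : Finset m) (T : Finset n) :
    (R.image (rowTrace S T)).vcDim ≤ signRank S := by
  obtain ⟨M, hM, hr⟩ := exists_rank_eq_signRank S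
  refine Finset.sup_le fun s hs => ?_
  have hli := linearIndependent_col_of_shatters hM (mem_shatterer.1 hs)
  calc #s = (M.submatrix id ((↑) : s → n)).rank := by
        rw [Matrix.rank_eq_finrank_span_cols, ← Fintype.card_coe]
        exact (finrank_span_eq_card hli).symm
    _ ≤ M.rank := Matrix.rank_submatrix_le _ _ _
    _ = signRank S := hr

end SignRank

section Packing

theorem card_mul_pow_vcDim_le {α : Type*} [DecidableEq α] {𝒜 : Finset (Finset α)} {T : Finset α}
    (h𝒜 : 𝒜 ⊆ T.powerset) {y : ℝ} (hy0 : 0 ≤ y) (hy1 : y ≤ 1) :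
    #𝒜 * y ^ 𝒜.vcDim ≤ (1 + y) ^ #T := by
  have hsub : 𝒜.shatterer ⊆ T.powerset := fun s hs => by
    obtain ⟨u, hu, hsu⟩ := (mem_shatterer.1 hs).exists_superset
    exact mem_powerset.2 (hsu.trans (mem_powerset.1 (h𝒜 hu)))
  calc #𝒜 * y ^ 𝒜.vcDim
      ≤ #𝒜.shatterer * y ^ 𝒜.vcDim := by
        gcongr ?_ * _
        exact_mod_cast 𝒜.card_le_card_shatterer
    _ = ∑ _s ∈ 𝒜.shatterer, y ^ 𝒜.vcDim := by rw [sum_const, nsmul_eq_mul]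
    _ ≤ ∑ s ∈ 𝒜.shatterer, y ^ #s := sum_le_sum fun s hs =>
        pow_le_pow_of_le_one hy0 hy1 (mem_shatterer.1 hs).card_le_vcDim
    _ ≤ ∑ s ∈ T.powerset, y ^ #s :=
        sum_le_sum_of_subset_of_nonneg hsub fun s _ _ => pow_nonneg hy0 _
    _ = (1 + y) ^ #T := by
        rw [add_comm, ← sum_pow_mul_eq_add_pow]
        simp only [one_pow, mul_one]

section HittingSet

variable {ι π : Type*} [Fintype ι] {w : ι → ℝ} {hit : π → ι → Prop}
  [∀ q, DecidablePred (hit q)] {δ : ℝ} {Q : Finset π}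

theorem exists_mul_card_le_card_filter_hit (hw : ∀ j, 0 ≤ w j) (hW : 0 < ∑ j, w j)
    (h : ∀ q ∈ Q, δ * ∑ j, w j ≤ ∑ j with hit q j, w j) :
    ∃ j, δ * #Q ≤ #{q ∈ Q | hit q j} := by
  by_contra! hlt
  obtain ⟨j₀, -, hj₀⟩ := exists_lt_of_sum_lt (s := univ) (f := fun _ => (0 : ℝ)) (g := w)
    (by simpa using hW)
  have : ∑ j, w j * (δ * #Q) < ∑ j, w j * (δ * #Q) :=
    calc ∑ j, w j * (δ * #Q) = ∑ _q ∈ Q, δ * ∑ j, w j := by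
          rw [← sum_mul, sum_const, nsmul_eq_mul]
          ring
      _ ≤ ∑ q ∈ Q, ∑ j with hit q j, w j := sum_le_sum h
      _ = ∑ j, w j * #{q ∈ Q | hit q j} := by
          simp only [sum_filter]
          rw [sum_comm]
          refine sum_congr rfl fun j _ => ?_
          rw [← sum_filter, sum_const, nsmul_eq_mul, mul_comm]
      _ < ∑ j, w j * (δ * #Q) :=
          sum_lt_sum (fun j _ => mul_le_mul_of_nonneg_left (hlt j).le (hw j))
            ⟨j₀, mem_univ _, mul_lt_mul_of_pos_left (hlt j₀) hj₀⟩
  exact this.false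

theorem exists_card_filter_forall_not_hit_le [DecidableEq ι] (hw : ∀ j, 0 ≤ w j)
    (hW : 0 < ∑ j, w j) (hδ : δ ≤ 1) (h : ∀ q ∈ Q, δ * ∑ j, w j ≤ ∑ j with hit q j, w j) (k : ℕ) :
    ∃ T : Finset ι, #T ≤ k ∧ #{q ∈ Q | ∀ j ∈ T, ¬ hit q j} ≤ (1 - δ) ^ k * #Q := by
  induction k with
  | zero => exact ⟨∅, by simp, by simp⟩
  | succ k ih =>
    obtain ⟨T, hT, hcard⟩ := ih
    set Q' := {q ∈ Q | ∀ j ∈ T, ¬ hit q j}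
    obtain ⟨j, hj⟩ := exists_mul_card_le_card_filter_hit (Q := Q') hw hW
      fun q hq => h q (mem_of_mem_filter q hq)
    have hsplit : (#{q ∈ Q' | hit q j} : ℝ) + #{q ∈ Q' | ¬ hit q j} = #Q' := by
      exact_mod_cast card_filter_add_card_filter_not _
    have hinsert : {q ∈ Q | ∀ i ∈ insert j T, ¬ hit q i} = {q ∈ Q' | ¬ hit q j} := by
      simp only [Q', filter_filter, forall_mem_insert, and_comm]
    refine ⟨insert j T, (card_insert_le _ _).trans (Nat.succ_le_succ hT), ?_⟩
    calc (#{q ∈ Q | ∀ i ∈ insert j T, ¬ hit q i} : ℝ)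
        = #{q ∈ Q' | ¬ hit q j} := by rw [hinsert]
      _ ≤ (1 - δ) * #Q' := by linarith
      _ ≤ (1 - δ) * ((1 - δ) ^ k * #Q) := mul_le_mul_of_nonneg_left hcard (by linarith)
      _ = (1 - δ) ^ (k + 1) * #Q := by ring

end HittingSet

section WeightedDist

variable {n α R : Type*} [Fintype n] [DecidableEq α]

/-- The weighted Hamming distance of two words: the total weight of the positions at which they
differ. -/
def weightedDist [AddCommMonoid R] (w : n → R) (u v : n → α) : R :=
  ∑ j with u j ≠ v j, w j

theorem weightedDist_comm [AddCommMonoid R] (w : n → R) (u v : n → α) :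
    weightedDist w u v = weightedDist w v u := by
  simp only [weightedDist, ne_comm]

theorem weightedDist_le_sum [AddCommMonoid R] [PartialOrder R] [IsOrderedAddMonoid R] {w : n → R}
    (hw : ∀ j, 0 ≤ w j) (u v : n → α) : weightedDist w u v ≤ ∑ j, w j :=
  sum_le_univ_sum_of_nonneg hw

end WeightedDist

theorem one_sub_pow_mul_sq_lt_one {r δ : ℝ} (hr : 0 < r) (hδ : δ ≤ 1) {k : ℕ}
    (hk : 2 * Real.log r < k * δ) : (1 - δ) ^ k * r ^ 2 < 1 :=
  calc (1 - δ) ^ k * r ^ 2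
      ≤ Real.exp (-δ) ^ k * Real.exp (Real.log r) ^ 2 := by
        rw [Real.exp_log hr]
        gcongr
        exact Real.one_sub_le_exp_neg δ
    _ = Real.exp (2 * Real.log r - k * δ) := by
        rw [← Real.exp_nat_mul, ← Real.exp_nat_mul, ← Real.exp_add]
        push_cast
        ring_nf
    _ < 1 := Real.exp_lt_one_iff.2 (by linarith)

variable {m n : Type*} [Fintype n] {S : Matrix m n ℤˣ} {w : n → ℝ} {δ : ℝ} {R : Finset m}

theorem exists_injOn_rowTrace (hw : ∀ j, 0 ≤ w j) (hW : 0 < ∑ j, w j) (hδ : δ ≤ 1)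
    (hR : (R : Set m).Pairwise fun i k => δ * ∑ j, w j ≤ weightedDist w (S i) (S k))
    {k : ℕ} (hk : (1 - δ) ^ k * #R ^ 2 < 1) :
    ∃ T : Finset n, #T ≤ k ∧ Set.InjOn (rowTrace S T) R := by
  classical
  obtain ⟨T, hT, hmiss⟩ := exists_card_filter_forall_not_hit_le (Q := R.offDiag)
    (hit := fun q j => S q.1 j ≠ S q.2 j) hw hW hδ
    (fun q hq => by
      obtain ⟨hi, hk, hne⟩ := mem_offDiag.1 hq
      exact hR hi hk hne) k
  refine ⟨T, hT, fun i hi l hl hil => by_contra fun hne => ?_⟩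
  have hmem : (i, l) ∈ ({q ∈ R.offDiag | ∀ j ∈ T, ¬ S q.1 j ≠ S q.2 j} : Finset (m × m)) :=
    mem_filter.2 ⟨mem_offDiag.2 ⟨hi, hl, hne⟩,
      fun j hj => not_not.2 (rowTrace_eq_rowTrace_iff.1 hil j hj)⟩
  have hone : (1 : ℝ) ≤ #{q ∈ R.offDiag | ∀ j ∈ T, ¬ S q.1 j ≠ S q.2 j} :=
    Nat.one_le_cast.2 (card_pos.2 ⟨_, hmem⟩)
  have hoff : (#R.offDiag : ℝ) ≤ #R ^ 2 := by
    exact_mod_cast (offDiag_card R).le.trans (by rw [pow_two]; exact Nat.sub_le _ _)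
  have := mul_le_mul_of_nonneg_left hoff (pow_nonneg (sub_nonneg.2 hδ) k)
  linarith

variable [Fintype m]

/-- Haussler's packing lemma, with `y` the parameter of the generating function of the
Sauer–Shelah bound. -/
theorem card_mul_pow_signRank_le (hw : ∀ j, 0 ≤ w j) (hW : 0 < ∑ j, w j) (hδ : δ ≤ 1)
    (hR : (R : Set m).Pairwise fun i k => δ * ∑ j, w j ≤ weightedDist w (S i) (S k))
    {k : ℕ} (hk : (1 - δ) ^ k * #R ^ 2 < 1) {y : ℝ} (hy0 : 0 ≤ y) (hy1 : y ≤ 1) :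
    #R * y ^ signRank S ≤ (1 + y) ^ k := by
  classical
  obtain ⟨T, hT, hinj⟩ := exists_injOn_rowTrace hw hW hδ hR hk
  set 𝒜 := R.image (rowTrace S T)
  have h𝒜 : 𝒜 ⊆ T.powerset := image_subset_iff.2 fun i _ => mem_powerset.2 (filter_subset _ _)
  calc #R * y ^ signRank S ≤ #R * y ^ 𝒜.vcDim := by
        gcongr #R * ?_
        exact pow_le_pow_of_le_one hy0 hy1 (vcDim_image_rowTrace_le_signRank S R T)
    _ = #𝒜 * y ^ 𝒜.vcDim := by rw [card_image_of_injOn hinj]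
    _ ≤ (1 + y) ^ #T := card_mul_pow_vcDim_le h𝒜 hy0 hy1
    _ ≤ (1 + y) ^ k := pow_le_pow_right₀ (by linarith) hT

theorem log_card_le_of_separated (hR1 : 1 < #R) (hw : ∀ j, 0 ≤ w j) (hW : 0 < ∑ j, w j)
    (hδ0 : 0 < δ) (hδ1 : δ ≤ 1)
    (hR : (R : Set m).Pairwise fun i k => δ * ∑ j, w j ≤ weightedDist w (S i) (S k)) :
    3 / 4 * Real.log #R ≤ signRank S * Real.log (8 / δ) + 1 / 8 := by
  have hr : (1 : ℝ) < #R := by exact_mod_cast hR1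
  have hlog : 0 < Real.log #R := Real.log_pos hr
  set k := ⌊2 * Real.log #R / δ⌋₊ + 1 with hk
  have hk_gt : 2 * Real.log #R < k * δ := by
    rw [← div_lt_iff₀ hδ0, hk]
    exact_mod_cast Nat.lt_floor_add_one _
  have hk_le : (k : ℝ) * δ ≤ 2 * Real.log #R + δ := by
    have : (k : ℝ) ≤ 2 * Real.log #R / δ + 1 := by
      rw [hk]
      push_cast
      gcongr
      exact Nat.floor_le (by positivity)
    calc (k : ℝ) * δ ≤ (2 * Real.log #R / δ + 1) * δ := by gcongr
      _ = 2 * Real.log #R + δ := by field_simp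
  have hmiss : (1 - δ) ^ k * #R ^ 2 < 1 := one_sub_pow_mul_sq_lt_one (by linarith) hδ1 hk_gt
  have hpack := Real.log_le_log (by positivity)
    (card_mul_pow_signRank_le hw hW hδ1 hR hmiss (y := δ / 8) (by positivity) (by linarith))
  have hexp : k * Real.log (1 + δ / 8) ≤ k * (δ / 8) := by
    gcongr
    linarith [Real.log_le_sub_one_of_pos (show 0 < 1 + δ / 8 by positivity)]
  rw [Real.log_mul (by positivity) (by positivity), Real.log_pow, Real.log_pow] at hpack
  have hinv : Real.log (8 / δ) = -Real.log (δ / 8) := by rw [← Real.log_inv, inv_div]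
  rw [hinv]
  linarith

theorem exists_close_pair (hR1 : 1 < #R) (hw : ∀ j, 0 ≤ w j) (hW : 0 < ∑ j, w j) :
    ∃ i ∈ R, ∃ k ∈ R, i ≠ k ∧
      weightedDist w (S i) (S k) ≤ 8 * signRank S / Real.log #R * ∑ j, w j := by
  by_contra! hfar
  obtain ⟨i, hi, k, hk, hik⟩ := one_lt_card.1 hR1
  obtain ⟨j, -, -⟩ := exists_ne_zero_of_sum_ne_zero hW.ne'
  have : Nonempty m := ⟨i⟩
  have : Nonempty n := ⟨j⟩
  have hd : (1 : ℝ) ≤ signRank S := by exact_mod_cast signRank_pos S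
  have hlog : 0 < Real.log #R := Real.log_pos (by exact_mod_cast hR1)
  set δ := 8 * signRank S / Real.log #R with hδ
  have hδ1 : δ ≤ 1 := (lt_of_mul_lt_mul_right
    (((hfar i hi k hk hik).trans_le (weightedDist_le_sum hw _ _)).trans_eq (one_mul _).symm)
    hW.le).le
  have hinv : 8 / δ = Real.log #R / signRank S := by
    rw [hδ]
    field_simp
  have hpack := log_card_le_of_separated hR1 hw hW (by positivity) hδ1
    fun i hi k hk hik => (hfar i hi k hk hik).le
  have hlogx : signRank S * Real.log (8 / δ) ≤ Real.log #R / 2 - signRank S * (1 - Real.log 2) := by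
    have htangent := Real.log_le_sub_one_of_pos (show 0 < 8 / δ / 2 by positivity)
    rw [Real.log_div (by positivity) (by norm_num)] at htangent
    calc signRank S * Real.log (8 / δ)
        ≤ signRank S * (8 / δ / 2 - 1 + Real.log 2) := by
          gcongr
          linarith
      _ = Real.log #R / 2 - signRank S * (1 - Real.log 2) := by
          rw [hinv]
          field_simp
          ring
  have := mul_le_mul_of_nonneg_right hd (show 0 ≤ 1 - Real.log 2 by linarith [Real.log_two_lt_d9])
  linarith [Real.log_two_lt_d9]

end Packing

section InverseLogarithms

theorem log_factorial_eq_sum {N : ℕ} (hN : 1 ≤ N) :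
    Real.log N.factorial = ∑ r ∈ Ioc 1 N, Real.log r := by
  induction N, hN using Nat.le_induction with
  | base => simp
  | succ N hN ih =>
    rw [sum_Ioc_succ_top hN, ← ih, Nat.factorial_succ, Nat.cast_mul,
      Real.log_mul (by positivity) (by positivity), add_comm]

theorem mul_log_sub_le_sum_log {N : ℕ} (hN : 1 ≤ N) :
    N * Real.log N - N ≤ ∑ r ∈ Ioc 1 N, Real.log r := by
  have hstirling := Stirling.le_log_factorial_stirling (Nat.one_le_iff_ne_zero.1 hN)
  have hlog : 0 ≤ Real.log N := Real.log_natCast_nonneg N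
  have hpi : 0 ≤ Real.log (2 * Real.pi) := Real.log_nonneg (by linarith [Real.pi_gt_three])
  rw [log_factorial_eq_sum hN] at hstirling
  linarith

theorem sum_inv_log_le {N : ℕ} (hN : 2 ≤ N) :
    ∑ r ∈ Ioc 1 N, (Real.log r)⁻¹ ≤ 3 * (N / Real.log N) := by
  have hlog : 0 < Real.log N := Real.log_pos (by exact_mod_cast hN)
  have hlog2 := Real.log_two_gt_d9
  have hterm : ∀ r ∈ Ioc 1 N,
      Real.log N * (Real.log r)⁻¹ ≤ 1 + (Real.log N - Real.log r) / Real.log 2 := fun r hr => by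
    obtain ⟨hr1, hrN⟩ := mem_Ioc.1 hr
    have h2r : Real.log 2 ≤ Real.log r := Real.log_le_log (by norm_num) (by exact_mod_cast hr1)
    have hrN' : Real.log r ≤ Real.log N :=
      Real.log_le_log (by positivity) (by exact_mod_cast hrN)
    have hr0 : Real.log r ≠ 0 := by linarith
    calc Real.log N * (Real.log r)⁻¹ = 1 + (Real.log N - Real.log r) / Real.log r := by
          field_simp
          ring_nf
      _ ≤ 1 + (Real.log N - Real.log r) / Real.log 2 := by
          gcongr
  have hcard : (#(Ioc 1 N) : ℝ) = N - 1 := by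
    rw [Nat.card_Ioc, Nat.cast_sub (by omega), Nat.cast_one]
  rw [← mul_div_assoc, le_div_iff₀ hlog, mul_comm, mul_sum]
  calc ∑ r ∈ Ioc 1 N, Real.log N * (Real.log r)⁻¹
      ≤ ∑ r ∈ Ioc 1 N, (1 + (Real.log N - Real.log r) / Real.log 2) := sum_le_sum hterm
    _ = (N - 1) + ((N - 1) * Real.log N - ∑ r ∈ Ioc 1 N, Real.log r) / Real.log 2 := by
        rw [sum_add_distrib, ← sum_div, sum_sub_distrib, sum_const, sum_const, nsmul_eq_mul,
          nsmul_eq_mul, hcard, mul_one]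
    _ ≤ N + N / Real.log 2 := by
        gcongr
        · linarith
        · linarith [mul_log_sub_le_sum_log (show 1 ≤ N by omega)]
    _ ≤ N + N * 2 := by
        rw [div_eq_mul_inv]
        gcongr
        rw [inv_le_comm₀ (by positivity) two_pos]
        linarith
    _ = 3 * N := by ring

end InverseLogarithms

section GreedyTree

variable {m n : Type*} [Fintype n] (S : Matrix m n ℤˣ)

/-- The weighted Hamming distance of two rows, where column `j` has weight `2 ^ κ j`. -/
def rowDist (κ : n → ℕ) (i k : m) : ℕ :=
  weightedDist (fun j => 2 ^ κ j) (S i) (S k)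

theorem cast_rowDist (κ : n → ℕ) (i k : m) :
    (rowDist S κ i k : ℝ) = weightedDist (fun j => 2 ^ κ j) (S i) (S k) := by
  simp [rowDist, weightedDist]

theorem rowDist_comm (κ : n → ℕ) (i k : m) : rowDist S κ i k = rowDist S κ k i :=
  weightedDist_comm _ _ _

/-- The rows `i` and `k` are distinct rows in `R` at the least distance. -/
structure IsClosestPair (R : Finset m) (κ : n → ℕ) (i k : m) : Prop where
  left_mem : i ∈ R
  right_mem : k ∈ R
  ne : i ≠ k
  rowDist_le {i' k' : m} : i' ∈ R → k' ∈ R → i' ≠ k' → rowDist S κ i k ≤ rowDist S κ i' k'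

variable [Fintype m]

variable {S} in
theorem IsClosestPair.sum_two_pow_le [Nonempty n] {R : Finset m} {κ : n → ℕ} {i k : m}
    (hik : IsClosestPair S R κ i k) :
    ∑ j, (2 : ℝ) ^ (κ j + if S i j ≠ S k j then 1 else 0) ≤
      Real.exp (8 * signRank S / Real.log #R) * ∑ j, (2 : ℝ) ^ κ j := by
  have hW : 0 < ∑ j, (2 : ℝ) ^ κ j := sum_pos (fun j _ => by positivity) univ_nonempty
  obtain ⟨i', hi', k', hk', hne, hclose⟩ := exists_close_pair (S := S)
    (one_lt_card.2 ⟨i, hik.left_mem, k, hik.right_mem, hik.ne⟩) (fun j => by positivity) hW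
  have hmin : (rowDist S κ i k : ℝ) ≤ rowDist S κ i' k' := by
    exact_mod_cast hik.rowDist_le hi' hk' hne
  rw [← cast_rowDist] at hclose
  have hnew : ∑ j, (2 : ℝ) ^ (κ j + if S i j ≠ S k j then 1 else 0) =
      ∑ j, (2 : ℝ) ^ κ j + rowDist S κ i k := by
    rw [cast_rowDist, weightedDist, sum_filter, ← sum_add_distrib]
    refine sum_congr rfl fun j _ => ?_
    split_ifs <;> ring
  calc ∑ j, (2 : ℝ) ^ (κ j + if S i j ≠ S k j then 1 else 0)
      ≤ (8 * signRank S / Real.log #R + 1) * ∑ j, (2 : ℝ) ^ κ j := by linarith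
    _ ≤ Real.exp (8 * signRank S / Real.log #R) * ∑ j, (2 : ℝ) ^ κ j := by
        gcongr
        exact Real.add_one_le_exp _

variable [DecidableEq m]

/-- The states of the greedy construction of a spanning tree on the rows. In each step one row `k`
of a closest pair `i`, `k` of active rows is attached to the other one and becomes inactive. In
`GreedyState S R κ`, the set of active rows is `R`, and `κ j` is the number of tree edges whose
ends differ in column `j`. -/
inductive GreedyState : Finset m → (n → ℕ) → Prop
  | start : GreedyState univ fun _ => 0
  | step {R : Finset m} {κ : n → ℕ} {i k : m} :
      GreedyState R κ → IsClosestPair S R κ i k →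
      GreedyState (R.erase k) fun j => κ j + if S i j ≠ S k j then 1 else 0

variable {S}

namespace GreedyState

variable {R : Finset m} {κ : n → ℕ}

theorem add_card_le (h : GreedyState S R κ) (j : n) : κ j + #R ≤ Fintype.card m := by
  induction h with
  | start => simp
  | step _ hik ih =>
    have := card_erase_add_one hik.right_mem
    dsimp only
    split_ifs <;> omega

/-- Inserting every row right after the row it is attached to causes at most two new sign changes
per column in which the two rows differ. -/
theorem exists_list_numChanges_le (h : GreedyState S R κ) {L : List m} (hL : ∀ i ∈ R, i ∈ L) :
    ∃ L' : List m, (∀ i, i ∈ L') ∧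
      ∀ j, numChanges (L'.map (S · j)) ≤ numChanges (L.map (S · j)) + 2 * κ j := by
  induction h generalizing L with
  | start => exact ⟨L, fun i => hL i (mem_univ i), fun j => by simp⟩
  | @step R κ i k _ hik ih =>
    obtain ⟨l₁, l₂, rfl⟩ := List.append_of_mem (hL i (mem_erase.2 ⟨hik.ne, hik.left_mem⟩))
    obtain ⟨L', hL', hchanges⟩ := ih (L := l₁ ++ i :: k :: l₂) fun r hr => by
      have := hL r
      grind
    refine ⟨L', hL', fun j => (hchanges j).trans ?_⟩
    have := numChanges_insert_le (l₁.map (S · j)) (l₂.map (S · j)) (S i j) (S k j)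
    simp only [List.map_append, List.map_cons]
    omega

theorem signRank_le (h : GreedyState S R κ) (hR : #R = 1) :
    signRank S ≤ 2 * univ.sup κ + 1 := by
  obtain ⟨r, rfl⟩ := card_eq_one.1 hR
  obtain ⟨L, hL, hchanges⟩ := h.exists_list_numChanges_le (L := [r]) (by simp)
  refine signRank_le_of_numChanges_le hL fun j => (hchanges j).trans ?_
  rw [List.map_singleton, numChanges, zero_add]
  exact Nat.mul_le_mul_left 2 (le_sup (mem_univ j))

theorem sum_two_pow_le [Nonempty n] (h : GreedyState S R κ) :
    ∑ j, (2 : ℝ) ^ κ j ≤ Fintype.card n *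
      Real.exp (∑ r ∈ Ioc #R (Fintype.card m), 8 * signRank S / Real.log r) := by
  induction h with
  | start => simp
  | @step R κ i k _ hik ih =>
    have hcard := card_erase_add_one hik.right_mem
    have hIoc : Ioc #(R.erase k) (Fintype.card m) = insert #R (Ioc #R (Fintype.card m)) := by
      have := card_le_univ R
      ext r
      simp only [mem_Ioc, mem_insert]
      omega
    refine hik.sum_two_pow_le.trans ?_
    rw [hIoc, sum_insert (by simp), Real.exp_add, mul_left_comm]
    gcongr

theorem mul_log_two_le [Nonempty n] (h : GreedyState S R κ) (hR : #R = 1)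
    (hm : 2 ≤ Fintype.card m) (j : n) :
    κ j * Real.log 2 ≤ Real.log (Fintype.card n) +
      24 * signRank S * (Fintype.card m / Real.log (Fintype.card m)) := by
  set E := ∑ r ∈ Ioc 1 (Fintype.card m), 8 * (signRank S : ℝ) / Real.log r
  have hpow : (2 : ℝ) ^ κ j ≤ Fintype.card n * Real.exp E :=
    calc (2 : ℝ) ^ κ j ≤ ∑ j, (2 : ℝ) ^ κ j :=
          single_le_sum (f := fun j => (2 : ℝ) ^ κ j) (fun j _ => by positivity) (mem_univ j)
      _ ≤ Fintype.card n * Real.exp E := by simpa only [hR] using h.sum_two_pow_le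
  calc κ j * Real.log 2 = Real.log (2 ^ κ j) := (Real.log_pow _ _).symm
    _ ≤ Real.log (Fintype.card n * Real.exp E) := Real.log_le_log (by positivity) hpow
    _ = Real.log (Fintype.card n) + E := by
        rw [Real.log_mul (by positivity) (by positivity), Real.log_exp]
    _ ≤ Real.log (Fintype.card n) +
          8 * signRank S * (3 * (Fintype.card m / Real.log (Fintype.card m))) := by
        simp only [E, div_eq_mul_inv _ (Real.log _), ← mul_sum]
        gcongr
        simpa only [div_eq_mul_inv] using sum_inv_log_le hm
    _ = _ := by ring

end GreedyState

theorem log_le_two_mul_div_log {x : ℝ} (hx : 1 < x) : Real.log x ≤ 2 * (x / Real.log x) := by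
  have hlog : 0 < Real.log x := Real.log_pos hx
  have := Real.quadratic_le_exp_of_nonneg hlog.le
  rw [Real.exp_log (by linarith)] at this
  rw [← mul_div_assoc, le_div_iff₀ hlog]
  nlinarith

theorem GreedyState.two_mul_sup_add_one_le {N : ℕ} (hN : 2 ≤ N) {S : Matrix (Fin N) (Fin N) ℤˣ}
    {R : Finset (Fin N)} {κ : Fin N → ℕ} (h : GreedyState S R κ) (hR : #R = 1) :
    ((2 * univ.sup κ + 1 : ℕ) : ℝ) ≤ 80 * (N / Real.log N) * signRank S := by
  have : Nonempty (Fin N) := ⟨⟨0, by omega⟩⟩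
  obtain ⟨j, -, hj⟩ := exists_mem_eq_sup univ univ_nonempty κ
  have hN1 : (1 : ℝ) < N := by exact_mod_cast hN
  have hd : (1 : ℝ) ≤ signRank S := by exact_mod_cast signRank_pos S
  have hlog : 0 < Real.log N := Real.log_pos hN1
  set q := (N : ℝ) / Real.log N with hq
  have hq1 : 1 ≤ q := by
    rw [hq, le_div_iff₀ hlog]
    linarith [Real.log_le_sub_one_of_pos (zero_lt_one.trans hN1)]
  have hqd : q ≤ q * signRank S := le_mul_of_one_le_right (by linarith) hd
  have hκ := h.mul_log_two_le hR (by rwa [Fintype.card_fin]) j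
  rw [Fintype.card_fin, ← hq] at hκ
  have hκ' : (κ j : ℝ) * 0.69 ≤ 26 * (q * signRank S) :=
    calc (κ j : ℝ) * 0.69 ≤ κ j * Real.log 2 := by
          gcongr
          linarith [Real.log_two_gt_d9]
      _ ≤ 26 * (q * signRank S) := by linarith [log_le_two_mul_div_log hN1]
  rw [hj]
  push_cast
  linarith

end GreedyTree

namespace RAM

section Store

/-- The store after the assignment of `v` to the register `x`. -/
def Store.setReg (s : Store) (x v : ℕ) : Store :=
  ⟨Function.update s.reg x v, s.arr⟩

/-- The store after the assignment of `v` to cell `k` of the array `a`. -/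
def Store.setArr (s : Store) (a k v : ℕ) : Store :=
  ⟨s.reg, Function.update s.arr a (Function.update (s.arr a) k v)⟩

variable {s s' s'' : Store}

@[simp]
theorem Store.setReg_reg (x v y : ℕ) : (s.setReg x v).reg y = if y = x then v else s.reg y :=
  Function.update_apply ..

@[simp]
theorem Store.setArr_reg (a k v : ℕ) : (s.setArr a k v).reg = s.reg :=
  rfl

@[simp]
theorem Store.setArr_arr (a k v a' k' : ℕ) :
    (s.setArr a k v).arr a' k' = if a' = a ∧ k' = k then v else s.arr a' k' := by
  simp only [setArr, Function.update_apply]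
  grind

/-- All numbers in the store have at most `b` binary digits. -/
structure Store.Bdd (b : ℕ) (s : Store) : Prop where
  reg_lt (x : ℕ) : s.reg x < 2 ^ b
  arr_lt (a k : ℕ) : s.arr a k < 2 ^ b

theorem Store.Bdd.setReg {b v : ℕ} (hs : s.Bdd b) (x : ℕ) (hv : v < 2 ^ b) :
    (s.setReg x v).Bdd b where
  reg_lt y := by
    rw [setReg_reg]
    split_ifs
    exacts [hv, hs.reg_lt y]
  arr_lt := hs.arr_lt

theorem Store.Bdd.setArr {b v : ℕ} (hs : s.Bdd b) (a k : ℕ) (hv : v < 2 ^ b) :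
    (s.setArr a k v).Bdd b where
  reg_lt := hs.reg_lt
  arr_lt a' k' := by
    rw [setArr_arr]
    split_ifs
    exacts [hv, hs.arr_lt a' k']

/-- The two stores agree outside the registers in `X` and the arrays in `A`. -/
structure Store.AgreeOff (X A : Finset ℕ) (s s' : Store) : Prop where
  reg_eq {x : ℕ} : x ∉ X → s'.reg x = s.reg x
  arr_eq {a : ℕ} : a ∉ A → s'.arr a = s.arr a

variable {X X' A A' : Finset ℕ}

theorem Store.AgreeOff.refl : AgreeOff X A s s :=
  ⟨fun _ => rfl, fun _ => rfl⟩

theorem Store.AgreeOff.trans (h : AgreeOff X A s s') (h' : AgreeOff X A s' s'') :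
    AgreeOff X A s s'' :=
  ⟨fun hx => (h'.reg_eq hx).trans (h.reg_eq hx), fun ha => (h'.arr_eq ha).trans (h.arr_eq ha)⟩

theorem Store.AgreeOff.mono (h : AgreeOff X A s s') (hX : X ⊆ X') (hA : A ⊆ A') :
    AgreeOff X' A' s s' :=
  ⟨fun hx => h.reg_eq (mt (@hX _) hx), fun ha => h.arr_eq (mt (@hA _) ha)⟩

theorem Store.AgreeOff.setReg (h : AgreeOff X A s s') {x : ℕ} (hx : x ∈ X) (v : ℕ) :
    AgreeOff X A s (s'.setReg x v) where
  reg_eq {y} hy := by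
    rw [setReg_reg, if_neg (by rintro rfl; exact hy hx), h.reg_eq hy]
  arr_eq := h.arr_eq

/-- The registers that a program assigns to. -/
def Prog.regs : Prog → Finset ℕ
  | skip => ∅
  | assign x _ => {x}
  | put _ _ _ => ∅
  | seq p q => p.regs ∪ q.regs
  | ite _ p q => p.regs ∪ q.regs
  | loop _ p => p.regs

/-- The arrays that a program assigns to. -/
def Prog.arrs : Prog → Finset ℕ
  | skip => ∅
  | assign _ _ => ∅
  | put a _ _ => {a}
  | seq p q => p.arrs ∪ q.arrs
  | ite _ p q => p.arrs ∪ q.arrs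
  | loop _ p => p.arrs

theorem Exec.agreeOff {p : Prog} {t : ℕ} (h : Exec p s t s') :
    Store.AgreeOff p.regs p.arrs s s' := by
  induction h with
  | skip => exact .refl
  | assign x e s =>
    exact ⟨fun hy => Function.update_of_ne (mt mem_singleton.2 hy) _ _, fun _ => rfl⟩
  | put a e f s =>
    exact ⟨fun _ => rfl, fun ha => Function.update_of_ne (mt mem_singleton.2 ha) _ _⟩
  | seq _ _ ih ih' =>
    exact (ih.mono subset_union_left subset_union_left).trans
      (ih'.mono subset_union_right subset_union_right)
  | ite_true _ _ ih => exact ih.mono subset_union_left subset_union_left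
  | ite_false _ _ ih => exact ih.mono subset_union_right subset_union_right
  | loop_true _ _ _ ih ih' => exact ih.trans ih'
  | loop_false => exact .refl

end Store

section TimeBound

/-- The size of a term in which constants are written in unary, so that it bounds their values
as well. -/
def Term.unarySize : Term → ℕ
  | lit n => n + 1
  | reg _ => 1
  | get _ e => e.unarySize + 1
  | add e f => e.unarySize + f.unarySize + 1
  | sub e f => e.unarySize + f.unarySize + 1
  | mul e f => e.unarySize + f.unarySize + 1

variable {R R' : Type*} [CommSemiring R] [CommSemiring R']

/-- A bound for the cost of a term in a store of numbers with at most `b` binary digits. It is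
defined over any semiring in order to be available as a number and as a polynomial. -/
def Term.costBound (b : R) (e : Term) : R :=
  e.unarySize * (1 + (b + 1) * e.unarySize)

/-- A bound for the running time of a program on numbers with at most `b` binary digits if every
loop is iterated at most `n` times. -/
def Prog.timeBound (b n : R) : Prog → R
  | skip => 1
  | assign _ e => 1 + e.costBound b
  | put _ e f => 1 + e.costBound b + f.costBound b
  | seq p q => p.timeBound b n + q.timeBound b n
  | ite e p q => 1 + e.costBound b + (p.timeBound b n + q.timeBound b n)
  | loop e p => (1 + e.costBound b) + n * (1 + e.costBound b + p.timeBound b n)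

theorem Term.map_costBound (f : R →+* R') (b : R) (e : Term) :
    f (e.costBound b) = e.costBound (f b) := by
  simp only [costBound, map_mul, map_add, map_one, map_natCast]

theorem Prog.map_timeBound (f : R →+* R') (b n : R) (p : Prog) :
    f (p.timeBound b n) = p.timeBound (f b) (f n) := by
  induction p <;>
    simp only [timeBound, map_add, map_mul, map_one, Term.map_costBound, *]

variable {b : ℕ} {s : Store}

theorem Term.val_lt (hs : s.Bdd b) (e : Term) : e.val s < 2 ^ ((b + 1) * e.unarySize) := by
  have hcell : ∀ {v} k, v < 2 ^ b → v < 2 ^ ((b + 1) * (k + 1)) := fun k hv =>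
    hv.trans_le (Nat.pow_le_pow_right two_pos (by nlinarith))
  have hop : ∀ {u v i j : ℕ}, u < 2 ^ ((b + 1) * i) → v < 2 ^ ((b + 1) * j) →
      u + v < 2 ^ ((b + 1) * (i + j + 1)) ∧ u * v < 2 ^ ((b + 1) * (i + j + 1)) := by
    intro u v i j hu hv
    have hmul : (u + 1) * (v + 1) ≤ 2 ^ ((b + 1) * (i + j + 1)) :=
      calc (u + 1) * (v + 1) ≤ 2 ^ ((b + 1) * i) * 2 ^ ((b + 1) * j) := Nat.mul_le_mul hu hv
        _ = 2 ^ ((b + 1) * (i + j)) := by rw [mul_add, pow_add]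
        _ ≤ 2 ^ ((b + 1) * (i + j + 1)) :=
            Nat.pow_le_pow_right two_pos (Nat.mul_le_mul_left _ (Nat.le_succ _))
    constructor <;> linarith [Nat.zero_le (u * v)]
  induction e with
  | lit n =>
    exact (Nat.lt_two_pow_self (n := n)).trans_le
      (Nat.pow_le_pow_right two_pos (by simp only [unarySize]; nlinarith))
  | reg x => exact hcell 0 (hs.reg_lt x)
  | get a e _ => exact hcell _ (hs.arr_lt a _)
  | add e f he hf => exact (hop he hf).1
  | sub e f he hf => exact (Nat.sub_le _ _).trans_lt ((Nat.le_add_right _ _).trans_lt (hop he hf).1)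
  | mul e f he hf => exact (hop he hf).2

theorem Term.cost_le (hs : s.Bdd b) (e : Term) : e.cost s ≤ e.costBound b := by
  have hsize : ∀ e : Term, Nat.size (e.val s) ≤ (b + 1) * e.unarySize := fun e =>
    Nat.size_le.2 (e.val_lt hs)
  have hop : ∀ {c c' u i j : ℕ}, c ≤ i * (1 + (b + 1) * i) → c' ≤ j * (1 + (b + 1) * j) →
      u ≤ (b + 1) * (i + j + 1) →
      c + c' + (1 + u) ≤ (i + j + 1) * (1 + (b + 1) * (i + j + 1)) := by
    intro c c' u i j hc hc' hu
    have hi : i * (1 + (b + 1) * i) ≤ i * (1 + (b + 1) * (i + j + 1)) := by gcongr; omega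
    have hj : j * (1 + (b + 1) * j) ≤ j * (1 + (b + 1) * (i + j + 1)) := by gcongr; omega
    linarith
  simp only [costBound, Nat.cast_id]
  induction e with
  | lit n =>
    exact (Nat.add_le_add_left (hsize (lit n)) 1).trans (Nat.le_mul_of_pos_left _ n.succ_pos)
  | reg x =>
    exact (Nat.add_le_add_left (hsize (reg x)) 1).trans (Nat.le_mul_of_pos_left _ one_pos)
  | get a e he => exact hop he (Nat.zero_le (0 * _)) (hsize (get a e))
  | add e f he hf => exact hop he hf (hsize (add e f))
  | sub e f he hf => exact hop he hf (hsize (sub e f))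
  | mul e f he hf => exact hop he hf (hsize (mul e f))

end TimeBound

section Wp

/-- The weakest precondition for total correctness within a time bound: started in a store `s` of
numbers with at most `b` binary digits, the program halts, in the time allotted to loops of at most
`n` iterations, in such a store again, and the latter satisfies `Q`. -/
def Wp (b n : ℕ) (p : Prog) (Q : Store → Prop) (s : Store) : Prop :=
  s.Bdd b → ∃ t s', Exec p s t s' ∧ t ≤ p.timeBound b n ∧ s'.Bdd b ∧ Q s'

variable {b n : ℕ} {p q : Prog} {Q Q' : Store → Prop} {s : Store} {e f : Term}

theorem Wp.mono (h : Wp b n p Q s)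
    (hQ : ∀ s', Store.AgreeOff p.regs p.arrs s s' → Q s' → Q' s') : Wp b n p Q' s := fun hs => by
  obtain ⟨t, s', hex, ht, hs', hq⟩ := h hs
  exact ⟨t, s', hex, ht, hs', hQ s' hex.agreeOff hq⟩

theorem Wp.skip (h : Q s) : Wp b n .skip Q s := fun hs =>
  ⟨1, s, .skip s, le_rfl, hs, h⟩

theorem Wp.assign {x : ℕ} (hv : s.Bdd b → e.val s < 2 ^ b) (h : Q (s.setReg x (e.val s))) :
    Wp b n (.assign x e) Q s := fun hs =>
  ⟨_, _, .assign x e s, Nat.add_le_add_left (e.cost_le hs) 1, hs.setReg x (hv hs), h⟩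

theorem Wp.put {a : ℕ} (hv : s.Bdd b → f.val s < 2 ^ b)
    (h : Q (s.setArr a (e.val s) (f.val s))) : Wp b n (.put a e f) Q s := fun hs =>
  ⟨_, _, .put a e f s, Nat.add_le_add (Nat.add_le_add_left (e.cost_le hs) 1) (f.cost_le hs),
    hs.setArr a _ (hv hs), h⟩

theorem Wp.seq (h : Wp b n p (Wp b n q Q) s) : Wp b n (.seq p q) Q s := fun hs => by
  obtain ⟨t, s', hex, ht, hs', hq⟩ := h hs
  obtain ⟨t', s'', hex', ht', hs'', hq'⟩ := hq hs'
  exact ⟨_, s'', hex.seq hex', Nat.add_le_add ht ht', hs'', hq'⟩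

theorem Wp.ite (hp : e.val s ≠ 0 → Wp b n p Q s) (hq : e.val s = 0 → Wp b n q Q s) :
    Wp b n (.ite e p q) Q s := fun hs => by
  have hcost := e.cost_le hs
  by_cases he : e.val s = 0
  · obtain ⟨t, s', hex, ht, hs', h⟩ := hq he hs
    refine ⟨_, s', hex.ite_false he, ?_, hs', h⟩
    simp only [Prog.timeBound]
    omega
  · obtain ⟨t, s', hex, ht, hs', h⟩ := hp he hs
    refine ⟨_, s', hex.ite_true he, ?_, hs', h⟩
    simp only [Prog.timeBound]
    omega

theorem exists_exec_loop_of_variant {I : ℕ → Store → Prop}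
    (hstep : ∀ k s, I (k + 1) s → e.val s ≠ 0 ∧ Wp b n p (I k) s)
    (hend : ∀ s, I 0 s → e.val s = 0) {k : ℕ} (hI : I k s) (hs : s.Bdd b) :
    ∃ t s', Exec (.loop e p) s t s' ∧
      t ≤ (1 + e.costBound b) + k * (1 + e.costBound b + p.timeBound b n) ∧ s'.Bdd b ∧ I 0 s' := by
  have hcost : ∀ {s : Store}, s.Bdd b → e.cost s ≤ e.costBound b := e.cost_le
  induction k generalizing s with
  | zero => exact ⟨_, s, .loop_false (hend s hI), by have := hcost hs; omega, hs, hI⟩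
  | succ k ih =>
    obtain ⟨he, hp⟩ := hstep k s hI
    obtain ⟨t, s', hex, ht, hs', hI'⟩ := hp hs
    obtain ⟨t', s'', hex', ht', hs'', hI''⟩ := ih hI' hs'
    refine ⟨_, s'', .loop_true he hex hex', ?_, hs'', hI''⟩
    rw [Nat.add_one_mul]
    have := hcost hs
    omega

theorem Wp.loop {I : ℕ → Store → Prop} {k : ℕ} (hk : k ≤ n)
    (hstep : ∀ k s, I (k + 1) s → e.val s ≠ 0 ∧ Wp b n p (I k) s)
    (hend : ∀ s, I 0 s → e.val s = 0) (hI : I k s) : Wp b n (.loop e p) (I 0) s := fun hs => by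
  obtain ⟨t, s', hex, ht, hs', hI'⟩ := exists_exec_loop_of_variant hstep hend hI hs
  refine ⟨t, s', hex, ht.trans ?_, hs', hI'⟩
  simp only [Prog.timeBound]
  gcongr

/-- Run the program `p` with register `x` taking the values `0, 1, …` below that of register
`y`. -/
def forLoop (x y : ℕ) (p : Prog) : Prog :=
  .seq (.assign x (.lit 0))
    (.loop (.sub (.reg y) (.reg x)) (.seq p (.assign x (.add (.reg x) (.lit 1)))))

theorem Wp.forLoop {x y : ℕ} (hxy : x ≠ y) (hx : x ∉ p.regs) (hy : y ∉ p.regs)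
    (hn : s.reg y ≤ n) (hnb : n < 2 ^ b) {I : ℕ → Store → Prop} (hI : I 0 (s.setReg x 0))
    (hstep : ∀ i s', i < s.reg y →
      Store.AgreeOff (forLoop x y p).regs (forLoop x y p).arrs s s' → s'.reg x = i → I i s' →
      Wp b n p (fun s'' => I (i + 1) (s''.setReg x (i + 1))) s') :
    Wp b n (forLoop x y p) (I (s.reg y)) s := by
  have hxmem : x ∈ (RAM.forLoop x y p).regs := by simp [RAM.forLoop, Prog.regs]
  have hymem : y ∉ (RAM.forLoop x y p).regs := by simp [RAM.forLoop, Prog.regs, hxy.symm, hy]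
  let J : ℕ → Store → Prop := fun k s' => k ≤ s.reg y ∧ s'.reg x = s.reg y - k ∧
    Store.AgreeOff (RAM.forLoop x y p).regs (RAM.forLoop x y p).arrs s s' ∧ I (s.reg y - k) s'
  refine .seq (.assign (fun _ => by simp [Term.val]) ((Wp.loop (I := J) hn ?_ ?_ ?_).mono ?_))
  · rintro k s' ⟨hk, hreg, hag, hIk⟩
    have hval : s.reg y - k = s.reg y - (k + 1) + 1 := by omega
    refine ⟨?_, .seq ((hstep _ s' (by omega) hag hreg hIk).mono fun s'' hag' hI' =>
      .assign (fun _ => ?_) ?_)⟩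
    · simp only [Term.val, hag.reg_eq hymem, hreg]
      omega
    · simp only [Term.val, hag'.reg_eq hx, hreg]
      omega
    · have hag'' := hag'.mono (X' := (RAM.forLoop x y p).regs) (A' := (RAM.forLoop x y p).arrs)
        (by simp [RAM.forLoop, Prog.regs]) (by simp [RAM.forLoop, Prog.arrs])
      simp only [J, Term.val, hag'.reg_eq hx, hreg, hval]
      exact ⟨by omega, by simp, (hag.trans hag'').setReg hxmem _, hI'⟩
  · rintro s' ⟨-, hreg, hag, -⟩
    simp [Term.val, hag.reg_eq hymem, hreg]
  · exact ⟨le_rfl, by simp [Term.val], Store.AgreeOff.refl.setReg hxmem _, by simpa [Term.val]⟩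
  · rintro s' - ⟨-, -, -, hI'⟩
    exact hI'

end Wp

section Program

/-- The number of rows and columns of the input. -/
abbrev Reg.size : ℕ := 0
abbrev Reg.rounds : ℕ := 1
abbrev Reg.round : ℕ := 2
abbrev Reg.row : ℕ := 3
abbrev Reg.row' : ℕ := 4
abbrev Reg.col : ℕ := 5
/-- One plus the distance of the rows `row` and `row'`. -/
abbrev Reg.dist : ℕ := 6
/-- One plus the distance of the rows `bestRow` and `bestRow'`, or `0` before the first pair of
rows has been found. -/
abbrev Reg.best : ℕ := 7
abbrev Reg.bestRow : ℕ := 8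
abbrev Reg.bestRow' : ℕ := 9
abbrev Reg.maxCount : ℕ := 10

/-- The entries of the input matrix, row by row. -/
abbrev Arr.entries : ℕ := 0
/-- The weights of the columns minus one, so that initially all cells are `0`. -/
abbrev Arr.weight : ℕ := 1
/-- The binary logarithms of the weights of the columns. -/
abbrev Arr.count : ℕ := 2
/-- The characteristic function of the set of inactive rows. -/
abbrev Arr.removed : ℕ := 3

/-- The entry of the input in the row held in register `x` and in column `Reg.col`. -/
def entryTerm (x : ℕ) : Term :=
  .get Arr.entries (.add (.mul (.reg x) (.reg Reg.size)) (.reg Reg.col))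

/-- The absolute difference of two entries in column `Reg.col`. -/
def diffTerm (x y : ℕ) : Term :=
  .add (.sub (entryTerm x) (entryTerm y)) (.sub (entryTerm y) (entryTerm x))

/-- Compute the weighted Hamming distance of two rows. -/
def distProg : Prog :=
  .seq (.assign Reg.dist (.lit 1))
    (forLoop Reg.col Reg.size (.assign Reg.dist (.add (.reg Reg.dist)
      (.mul (.add (.get Arr.weight (.reg Reg.col)) (.lit 1)) (diffTerm Reg.row Reg.row')))))

/-- Replace the best pair of rows by the current one if the latter is closer. -/
def improveProg : Prog :=
  .ite (.add (.sub (.reg Reg.best) (.reg Reg.dist)) (.sub (.lit 1) (.reg Reg.best)))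
    (.seq (.assign Reg.best (.reg Reg.dist))
      (.seq (.assign Reg.bestRow (.reg Reg.row)) (.assign Reg.bestRow' (.reg Reg.row'))))
    .skip

/-- Take the current pair of rows into account if both rows are active. -/
def visitProg : Prog :=
  .ite (.add (.get Arr.removed (.reg Reg.row)) (.get Arr.removed (.reg Reg.row')))
    .skip (.seq distProg improveProg)

/-- Take the pairs of `Reg.row'` and the rows before it into account. -/
def visitRowsProg : Prog :=
  forLoop Reg.row Reg.row' visitProg

/-- Find a closest pair of active rows. -/
def searchProg : Prog :=
  .seq (.assign Reg.best (.lit 0)) (forLoop Reg.row' Reg.size visitRowsProg)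

/-- Double the weight of the current column if the rows of the best pair differ in it. -/
def doubleProg : Prog :=
  .seq
    (.put Arr.weight (.reg Reg.col) (.add (.get Arr.weight (.reg Reg.col))
      (.mul (.add (.get Arr.weight (.reg Reg.col)) (.lit 1))
        (diffTerm Reg.bestRow Reg.bestRow'))))
    (.put Arr.count (.reg Reg.col)
      (.add (.get Arr.count (.reg Reg.col)) (diffTerm Reg.bestRow Reg.bestRow')))

/-- Double the weights of the columns in which the rows of the best pair differ. -/
def updateProg : Prog :=
  forLoop Reg.col Reg.size doubleProg

/-- One step of the greedy construction of the spanning tree. -/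
def roundProg : Prog :=
  .seq searchProg (.seq updateProg (.put Arr.removed (.reg Reg.bestRow') (.lit 1)))

/-- Output twice the largest number of doublings of the weight of a column, plus one. -/
def outputProg : Prog :=
  .seq (.assign Reg.maxCount (.lit 0))
    (.seq (forLoop Reg.col Reg.size (.assign Reg.maxCount (.add (.reg Reg.maxCount)
        (.sub (.get Arr.count (.reg Reg.col)) (.reg Reg.maxCount)))))
      (.assign Reg.size (.add (.mul (.lit 2) (.reg Reg.maxCount)) (.lit 1))))

/-- The approximation algorithm for the sign rank. -/
def signRankProg : Prog :=
  .seq (.assign Reg.rounds (.sub (.reg Reg.size) (.lit 1)))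
    (.seq (forLoop Reg.round Reg.rounds roundProg) outputProg)

end Program

section Correctness

variable {N : ℕ} {S : Matrix (Fin N) (Fin N) ℤˣ} {R : Finset (Fin N)} {κ : Fin N → ℕ}
  {s s' : Store}

theorem input_arr_entries (S : Matrix (Fin N) (Fin N) ℤˣ) (i j : Fin N) :
    (input S).arr Arr.entries (i * N + j) = if S i j = 1 then 1 else 0 := by
  have hidx : (i : ℕ) * N + j = Fin.mkDivMod i j := by rw [Fin.coe_mkDivMod, mul_comm]
  simp only [hidx, input, Fin.is_lt, and_self, dite_true, Fin.eta, Fin.divNat_mkDivMod,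
    Fin.modNat_mkDivMod]

theorem lt_two_pow_two_mul_add_two (N : ℕ) : N < 2 ^ (2 * N + 2) :=
  Nat.lt_two_pow_self.trans_le (Nat.pow_le_pow_right two_pos (by omega))

theorem input_bdd (S : Matrix (Fin N) (Fin N) ℤˣ) : (input S).Bdd (2 * N + 2) where
  reg_lt x := by
    have := lt_two_pow_two_mul_add_two N
    simp only [input]
    split_ifs <;> omega
  arr_lt a k := by
    have : 1 < 2 ^ (2 * N + 2) := Nat.one_lt_two_pow (by omega)
    simp only [input]
    split_ifs <;> omega

/-- The store `s` holds the input `S` and the state of the greedy construction with set `R` of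
active rows and exponents `κ` of the weights. -/
structure Encodes (S : Matrix (Fin N) (Fin N) ℤˣ) (R : Finset (Fin N)) (κ : Fin N → ℕ)
    (s : Store) : Prop where
  size : s.reg Reg.size = N
  entries : s.arr Arr.entries = (input S).arr Arr.entries
  weight_add_one (j : Fin N) : s.arr Arr.weight j + 1 = 2 ^ κ j
  count (j : Fin N) : s.arr Arr.count j = κ j
  removed (i : Fin N) : s.arr Arr.removed i = if i ∈ R then 0 else 1

theorem encodes_input (S : Matrix (Fin N) (Fin N) ℤˣ) :
    Encodes S univ (fun _ => 0) (input S) where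
  size := rfl
  entries := rfl
  weight_add_one _ := rfl
  count _ := rfl
  removed i := by simp [input]

theorem Encodes.of_agreeOff {X A : Finset ℕ} (hs : Encodes S R κ s)
    (h : Store.AgreeOff X A s s') (hX : Reg.size ∉ X) (hA : A = ∅) : Encodes S R κ s' := by
  have harr : s'.arr = s.arr := funext fun a => h.arr_eq (hA ▸ notMem_empty a)
  exact ⟨(h.reg_eq hX).trans hs.size, harr ▸ hs.entries, harr ▸ hs.weight_add_one,
    harr ▸ hs.count, harr ▸ hs.removed⟩

theorem Encodes.setReg (hs : Encodes S R κ s) {x : ℕ} (hx : x ≠ Reg.size) (v : ℕ) :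
    Encodes S R κ (s.setReg x v) :=
  hs.of_agreeOff (X := {x}) (Store.AgreeOff.refl.setReg (mem_singleton_self x) v)
    (mt mem_singleton.1 hx.symm) rfl

theorem val_diffTerm {x y : ℕ} {i k j : Fin N} (hsize : s.reg Reg.size = N)
    (hentries : s.arr Arr.entries = (input S).arr Arr.entries) (hx : s.reg x = i)
    (hy : s.reg y = k) (hj : s.reg Reg.col = j) :
    (diffTerm x y).val s = if S i j ≠ S k j then 1 else 0 := by
  simp only [diffTerm, entryTerm, Term.val, hx, hy, hsize, hj, hentries, input_arr_entries]
  rcases Int.units_eq_one_or (S i j) with hi | hi <;>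
    rcases Int.units_eq_one_or (S k j) with hk | hk <;> simp [hi, hk]

theorem filter_val_lt_add_one (j : Fin N) :
    (univ.filter fun i : Fin N => i.val < j + 1) =
      insert j (univ.filter fun i : Fin N => i.val < j) := by
  ext i
  simp only [mem_filter_univ, mem_insert, Fin.ext_iff]
  omega

theorem one_add_sum_two_pow_lt (hκ : ∀ j, κ j ≤ N) (T : Finset (Fin N)) :
    1 + ∑ j ∈ T, 2 ^ κ j < 2 ^ (2 * N + 2) := by
  have hsum : ∑ j ∈ T, 2 ^ κ j ≤ 2 ^ N * 2 ^ N :=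
    calc ∑ j ∈ T, 2 ^ κ j ≤ #T • 2 ^ N :=
          sum_le_card_nsmul _ _ _ fun j _ => Nat.pow_le_pow_right two_pos (hκ j)
      _ ≤ 2 ^ N * 2 ^ N := by
          rw [smul_eq_mul]
          gcongr
          exact (card_finset_fin_le T).trans Nat.lt_two_pow_self.le
  have h1 : 1 ≤ 2 ^ N * 2 ^ N := Nat.one_le_iff_ne_zero.2 (by positivity)
  calc 1 + ∑ j ∈ T, 2 ^ κ j < 4 * (2 ^ N * 2 ^ N) := by omega
    _ = 2 ^ (2 * N + 2) := by ring

theorem Wp.forLoop_size {x : ℕ} {p : Prog} (hs : s.reg Reg.size = N) (hx : x ≠ Reg.size)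
    (hxp : x ∉ p.regs) (hp : Reg.size ∉ p.regs) {I : ℕ → Store → Prop}
    (hI : I 0 (s.setReg x 0))
    (hstep : ∀ (i : Fin N) (s' : Store),
      Store.AgreeOff (RAM.forLoop x Reg.size p).regs (RAM.forLoop x Reg.size p).arrs s s' →
      s'.reg x = i → I i s' → Wp (2 * N + 2) N p (fun s'' => I (i + 1) (s''.setReg x (i + 1))) s') :
    Wp (2 * N + 2) N (RAM.forLoop x Reg.size p) (I N) s := by
  refine Wp.mono (Wp.forLoop hx hxp hp hs.le (lt_two_pow_two_mul_add_two N) hI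
    fun i s' hi hag hreg hIi => hstep ⟨i, hs ▸ hi⟩ s' hag hreg hIi) fun s' _ h => ?_
  rwa [hs] at h

theorem Encodes.wp_distProg (hs : Encodes S R κ s) (hκ : ∀ j, κ j ≤ N) {i k : Fin N}
    (hi : s.reg Reg.row = i) (hk : s.reg Reg.row' = k) :
    Wp (2 * N + 2) N distProg (fun s' => s'.reg Reg.dist = 1 + rowDist S κ i k) s := by
  let partialDist (c : ℕ) : ℕ := ∑ j with j.val < c, if S i j ≠ S k j then 2 ^ κ j else 0
  have hend : partialDist N = rowDist S κ i k := by
    simp [partialDist, rowDist, weightedDist, sum_filter]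
  have hlt (c : ℕ) : 1 + partialDist c < 2 ^ (2 * N + 2) := by
    simp only [partialDist, ← sum_filter]
    exact one_add_sum_two_pow_lt hκ _
  have hstep (j : Fin N) : 1 + partialDist (j + 1) =
      1 + partialDist j + 2 ^ κ j * if S i j ≠ S k j then 1 else 0 := by
    simp only [partialDist]
    rw [filter_val_lt_add_one, sum_insert (by simp)]
    split_ifs <;> ring
  refine .seq (.assign (fun _ => Nat.one_lt_two_pow (by omega)) ?_)
  have hs₁ : Encodes S R κ (s.setReg Reg.dist 1) := hs.setReg (by decide) 1
  rw [← hend]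
  refine Wp.forLoop_size (I := fun c s' => s'.reg Reg.dist = 1 + partialDist c) (by exact hs₁.size)
    (by decide) (by decide) (by decide) (by simp [partialDist, Term.val])
    fun j s' hag hcol hdist => ?_
  have hs' : Encodes S R κ s' := hs₁.of_agreeOff hag (by decide) (by rfl)
  have hdiff := val_diffTerm hs'.size hs'.entries
    (show s'.reg Reg.row = i from (hag.reg_eq (by decide)).trans hi)
    (show s'.reg Reg.row' = k from (hag.reg_eq (by decide)).trans hk) hcol
  have hval : s'.reg Reg.dist + (s'.arr Arr.weight (s'.reg Reg.col) + 1) *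
      (diffTerm Reg.row Reg.row').val s' = 1 + partialDist (j + 1) := by
    rw [hstep, ← hdist, hdiff, hcol, hs'.weight_add_one]
  exact .assign (fun _ => hval.trans_lt (hlt _)) hval

/-- The registers `Reg.bestRow` and `Reg.bestRow'` hold a closest pair among the pairs of rows that
satisfy `seen`, and `Reg.best` holds one plus its distance, or `0` if there is no such pair. -/
def IsBest (S : Matrix (Fin N) (Fin N) ℤˣ) (κ : Fin N → ℕ) (seen : Fin N → Fin N → Prop)
    (s : Store) : Prop :=
  (s.reg Reg.best = 0 ∧ ∀ i k, ¬ seen i k) ∨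
    ∃ i k : Fin N, s.reg Reg.bestRow = i ∧ s.reg Reg.bestRow' = k ∧
      s.reg Reg.best = 1 + rowDist S κ i k ∧ seen i k ∧
        ∀ i' k', seen i' k' → rowDist S κ i k ≤ rowDist S κ i' k'

section IsBest

variable {seen seen' : Fin N → Fin N → Prop} {i k : Fin N}

theorem IsBest.congr (h : IsBest S κ seen s) (hseen : ∀ i k, seen i k ↔ seen' i k) :
    IsBest S κ seen' s := by
  simpa only [IsBest, hseen] using h

theorem IsBest.of_agreeOff {X A : Finset ℕ} (h : IsBest S κ seen s)
    (hag : Store.AgreeOff X A s s') (hX : Disjoint X {Reg.best, Reg.bestRow, Reg.bestRow'}) :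
    IsBest S κ seen s' := by
  simp only [disjoint_insert_right, disjoint_singleton_right] at hX
  simpa only [IsBest, hag.reg_eq hX.1, hag.reg_eq hX.2.1, hag.reg_eq hX.2.2] using h

theorem IsBest.wp_improveProg {b n : ℕ} (hbest : IsBest S κ seen s) (hi : s.reg Reg.row = i)
    (hk : s.reg Reg.row' = k) (hdist : s.reg Reg.dist = 1 + rowDist S κ i k) :
    Wp b n improveProg (IsBest S κ fun i' k' => seen i' k' ∨ i' = i ∧ k' = k) s := by
  refine .ite (fun hlt => ?_) fun hle => .skip ?_
  · refine .seq (.assign (fun hs => hs.reg_lt _) (.seq (.assign (fun hs => hs.reg_lt _)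
      (.assign (fun hs => hs.reg_lt _) (.inr ⟨i, k, hi, hk, hdist, .inr ⟨rfl, rfl⟩, ?_⟩)))))
    rintro i' k' (hseen | ⟨rfl, rfl⟩)
    · rcases hbest with ⟨-, hnone⟩ | ⟨i₀, k₀, -, -, hd, -, hmin⟩
      · exact absurd hseen (hnone i' k')
      · have := hmin i' k' hseen
        simp only [Term.val] at hlt
        omega
    · exact le_rfl
  · simp only [Term.val] at hle
    rcases hbest with ⟨h0, -⟩ | ⟨i₀, k₀, hi₀, hk₀, hd, hseen, hmin⟩
    · omega
    · refine .inr ⟨i₀, k₀, hi₀, hk₀, hd, .inl hseen, ?_⟩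
      rintro i' k' (hseen' | ⟨rfl, rfl⟩)
      · exact hmin i' k' hseen'
      · omega

theorem Encodes.wp_visitProg (hs : Encodes S R κ s) (hκ : ∀ j, κ j ≤ N)
    (hbest : IsBest S κ seen s) (hi : s.reg Reg.row = i) (hk : s.reg Reg.row' = k) :
    Wp (2 * N + 2) N visitProg
      (IsBest S κ fun i' k' => seen i' k' ∨ i ∈ R ∧ k ∈ R ∧ i' = i ∧ k' = k) s := by
  have hval : s.arr Arr.removed (s.reg Reg.row) + s.arr Arr.removed (s.reg Reg.row') = 0 ↔
      i ∈ R ∧ k ∈ R := by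
    rw [hi, hk, hs.removed, hs.removed]
    split_ifs <;> simp_all
  refine .ite (fun hne => .skip (hbest.congr fun i' k' => ?_)) fun heq => ?_
  · have := mt hval.2 hne
    tauto
  · obtain ⟨hiR, hkR⟩ := hval.1 heq
    refine .seq ((hs.wp_distProg hκ hi hk).mono fun s' hag hdist => ?_)
    refine ((hbest.of_agreeOff hag (by decide)).wp_improveProg ((hag.reg_eq (by decide)).trans hi)
      ((hag.reg_eq (by decide)).trans hk) hdist).mono fun s'' _ h => h.congr fun i' k' => ?_
    simp only [hiR, hkR, true_and]

end IsBest

/-- The pairs of active rows that the search has visited when `Reg.row'` and `Reg.row` have the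
values `c` and `r`. -/
def Visited (R : Finset (Fin N)) (c r : ℕ) (i k : Fin N) : Prop :=
  i ∈ R ∧ k ∈ R ∧ i < k ∧ (k.val < c ∨ k.val = c ∧ i.val < r)

theorem IsBest.exists_isClosestPair (hbest : IsBest S κ (Visited R N 0) s) (hR : 1 < #R) :
    ∃ i k : Fin N, IsClosestPair S R κ i k ∧ s.reg Reg.bestRow = i ∧ s.reg Reg.bestRow' = k := by
  have hvisited {i k : Fin N} (hi : i ∈ R) (hk : k ∈ R) (hik : i < k) : Visited R N 0 i k :=
    ⟨hi, hk, hik, .inl k.2⟩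
  rcases hbest with ⟨-, hnone⟩ | ⟨i, k, hi, hk, -, ⟨hiR, hkR, hik, -⟩, hmin⟩
  · obtain ⟨i, hi, k, hk, hne⟩ := one_lt_card.1 hR
    rcases hne.lt_or_gt with hlt | hgt
    exacts [absurd (hvisited hi hk hlt) (hnone i k), absurd (hvisited hk hi hgt) (hnone k i)]
  · refine ⟨i, k, ⟨hiR, hkR, hik.ne, fun {i' k'} hi' hk' hne => ?_⟩, hi, hk⟩
    rcases hne.lt_or_gt with hlt | hgt
    · exact hmin i' k' (hvisited hi' hk' hlt)
    · exact (hmin k' i' (hvisited hk' hi' hgt)).trans_eq (rowDist_comm S κ k' i')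

theorem Encodes.wp_visitRowsProg (hs : Encodes S R κ s) (hκ : ∀ j, κ j ≤ N) {k : Fin N}
    (hbest : IsBest S κ (Visited R k 0) s) (hk : s.reg Reg.row' = k) :
    Wp (2 * N + 2) N visitRowsProg (IsBest S κ (Visited R (k + 1) 0)) s := by
  refine Wp.mono (Wp.forLoop (I := fun r => IsBest S κ (Visited R k r)) (by decide) (by decide)
    (by decide) (hk.trans_le k.2.le) (lt_two_pow_two_mul_add_two N) hbest
    fun r s' hr hag hi hbest' => ?_) fun s' _ hbest' => hbest'.congr fun i' k' => ?_
  · rw [hk] at hr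
    have hs' : Encodes S R κ s' := hs.of_agreeOff hag (by decide) (by rfl)
    refine (hs'.wp_visitProg hκ (i := ⟨r, hr.trans k.2⟩) hbest' hi
      ((hag.reg_eq (by decide)).trans hk)).mono fun s'' _ h => h.congr fun i' k' => ?_
    grind [Visited, Fin.lt_def, Fin.ext_iff]
  · simp only [Visited, hk, Fin.lt_def]
    grind

theorem Encodes.wp_searchProg (hs : Encodes S R κ s) (hκ : ∀ j, κ j ≤ N) (hR : 1 < #R) :
    Wp (2 * N + 2) N searchProg (fun s' => ∃ i k : Fin N, IsClosestPair S R κ i k ∧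
      s'.reg Reg.bestRow = i ∧ s'.reg Reg.bestRow' = k) s := by
  refine .seq (.assign (fun _ => by simp [Term.val]) ?_)
  have hs₁ : Encodes S R κ (s.setReg Reg.best 0) := hs.setReg (by decide) 0
  refine Wp.mono (Wp.forLoop_size (I := fun c => IsBest S κ (Visited R c 0)) (by exact hs₁.size)
    (by decide) (by decide) (by decide) (.inl ⟨rfl, by simp [Visited]⟩)
    fun k s' hag hk hbest => ?_) fun s' _ hbest => hbest.exists_isClosestPair hR
  have hs' : Encodes S R κ s' := hs₁.of_agreeOff hag (by decide) (by rfl)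
  exact hs'.wp_visitRowsProg hκ hbest hk

theorem Encodes.setArr_weight_count (hs : Encodes S R κ s) (j : Fin N) {v w : ℕ}
    (hw : w + 1 = 2 ^ v) :
    Encodes S R (Function.update κ j v)
      ((s.setArr Arr.weight j w).setArr Arr.count j v) where
  size := hs.size
  entries := hs.entries
  weight_add_one j' := by
    rcases eq_or_ne j' j with rfl | hj
    · simpa using hw
    · simpa [hj, Fin.val_ne_of_ne hj] using hs.weight_add_one j'
  count j' := by
    rcases eq_or_ne j' j with rfl | hj
    · simp
    · simpa [hj, Fin.val_ne_of_ne hj] using hs.count j'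
  removed i := by simpa using hs.removed i

theorem Encodes.setArr_removed (hs : Encodes S R κ s) (k : Fin N) :
    Encodes S (R.erase k) κ (s.setArr Arr.removed k 1) where
  size := hs.size
  entries := hs.entries
  weight_add_one j := by simpa using hs.weight_add_one j
  count j := by simpa using hs.count j
  removed i := by
    rcases eq_or_ne i k with rfl | hi
    · simp
    · simpa [hi, Fin.val_ne_of_ne hi] using hs.removed i

theorem Encodes.wp_doubleProg (hs : Encodes S R κ s) {i k j : Fin N} (hκ : κ j < N)
    (hi : s.reg Reg.bestRow = i) (hk : s.reg Reg.bestRow' = k) (hj : s.reg Reg.col = j) :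
    Wp (2 * N + 2) N doubleProg
      (Encodes S R (Function.update κ j (κ j + if S i j ≠ S k j then 1 else 0))) s := by
  set δ : ℕ := if S i j ≠ S k j then 1 else 0 with hδ
  have hdiff : (diffTerm Reg.bestRow Reg.bestRow').val s = δ :=
    val_diffTerm hs.size hs.entries hi hk hj
  have hdiff' (w : ℕ) : (diffTerm Reg.bestRow Reg.bestRow').val (s.setArr Arr.weight j w) = δ :=
    val_diffTerm (s := s.setArr Arr.weight j w) hs.size hs.entries hi hk hj
  have hweight : s.arr Arr.weight j + (s.arr Arr.weight j + 1) * δ + 1 = 2 ^ (κ j + δ) := by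
    rw [add_right_comm, hs.weight_add_one, hδ]
    split_ifs <;> ring
  have hle : κ j + δ ≤ N := by
    rw [hδ]
    split_ifs <;> omega
  refine .seq (.put (fun _ => ?_) (.put (fun _ => ?_) ?_))
  · have : 2 ^ (κ j + δ) ≤ 2 ^ (2 * N + 2) := Nat.pow_le_pow_right two_pos (by omega)
    simp only [Term.val, hj, hdiff]
    omega
  · simpa [Term.val, hj, hdiff, hdiff', hs.count] using
      hle.trans_lt (lt_two_pow_two_mul_add_two N)
  · simpa [Term.val, hj, hdiff, hdiff', hs.count] using hs.setArr_weight_count j hweight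

theorem Encodes.wp_updateProg (hs : Encodes S R κ s) (hκ : ∀ j, κ j < N) {i k : Fin N}
    (hi : s.reg Reg.bestRow = i) (hk : s.reg Reg.bestRow' = k) :
    Wp (2 * N + 2) N updateProg
      (Encodes S R fun j => κ j + if S i j ≠ S k j then 1 else 0) s := by
  let δ (j : Fin N) : ℕ := if S i j ≠ S k j then 1 else 0
  let κ' (c : ℕ) (j : Fin N) : ℕ := if j.val < c then κ j + δ j else κ j
  have hend : κ' N = fun j => κ j + δ j := by simp [κ']
  have hcur (j : Fin N) : κ' j j = κ j := if_neg (lt_irrefl _)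
  have hstep (j : Fin N) : κ' (j + 1) = Function.update (κ' j) j (κ' j j + δ j) := by
    ext j'
    rcases eq_or_ne j' j with rfl | hj
    · simp [κ']
    · simp only [κ', Function.update_of_ne hj, Nat.lt_add_one_iff_lt_or_eq,
        Fin.val_ne_of_ne hj, or_false]
  rw [← hend]
  refine Wp.forLoop_size (I := fun c => Encodes S R (κ' c)) hs.size (by decide) (by decide)
    (by decide) ?_ fun j s' hag hj hs' => ?_
  · simpa [κ'] using hs.setReg (x := Reg.col) (by decide) 0
  · rw [hstep]
    exact (hs'.wp_doubleProg ((hcur j).trans_lt (hκ j)) ((hag.reg_eq (by decide)).trans hi)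
      ((hag.reg_eq (by decide)).trans hk) hj).mono fun _ _ h => h.setReg (by decide) _

theorem Encodes.wp_roundProg (hs : Encodes S R κ s) (hκ : ∀ j, κ j < N) (hR : 1 < #R) :
    Wp (2 * N + 2) N roundProg (fun s' => ∃ i k : Fin N, IsClosestPair S R κ i k ∧
      Encodes S (R.erase k) (fun j => κ j + if S i j ≠ S k j then 1 else 0) s') s := by
  refine .seq ((hs.wp_searchProg (fun j => (hκ j).le) hR).mono
    fun s' hag ⟨i, k, hik, hi, hk⟩ => ?_)
  have hs' : Encodes S R κ s' := hs.of_agreeOff hag (by decide) (by rfl)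
  refine .seq ((hs'.wp_updateProg hκ hi hk).mono fun s'' hag' hs'' => ?_)
  refine .put (fun _ => Nat.one_lt_two_pow (by omega)) ⟨i, k, hik, ?_⟩
  have hk'' : s''.reg Reg.bestRow' = k := (hag'.reg_eq (by decide)).trans hk
  simpa only [Term.val, hk''] using hs''.setArr_removed k

theorem Encodes.wp_outputProg (hs : Encodes S R κ s) (hκ : ∀ j, κ j ≤ N) :
    Wp (2 * N + 2) N outputProg (fun s' => s'.reg 0 = 2 * univ.sup κ + 1) s := by
  let partialSup (c : ℕ) : ℕ := (univ.filter fun j : Fin N => j.val < c).sup κ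
  have hend : partialSup N = univ.sup κ := by simp [partialSup]
  have hN := lt_two_pow_two_mul_add_two N
  have hle (c : ℕ) : partialSup c ≤ N := Finset.sup_le fun j _ => hκ j
  have hstep (j : Fin N) : partialSup (j + 1) = partialSup j + (κ j - partialSup j) := by
    simp only [partialSup]
    rw [filter_val_lt_add_one, sup_insert]
    omega
  refine .seq (.assign (fun _ => by simp [Term.val]) (.seq ?_))
  have hs₁ : Encodes S R κ (s.setReg Reg.maxCount 0) := hs.setReg (by decide) 0
  refine Wp.mono (Wp.forLoop_size (I := fun c s' => s'.reg Reg.maxCount = partialSup c)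
    (by exact hs₁.size) (by decide) (by decide) (by decide) (by simp [partialSup, Term.val])
    fun j s' hag hcol hmax => ?_) fun s' _ hmax => .assign ?_ ?_
  · have hs' : Encodes S R κ s' := hs₁.of_agreeOff hag (by decide) (by rfl)
    have hval : s'.reg Reg.maxCount + (s'.arr Arr.count (s'.reg Reg.col) - s'.reg Reg.maxCount) =
        partialSup (j + 1) := by
      rw [hstep, hmax, hcol, hs'.count]
    exact .assign (fun _ => hval.trans_lt ((hle _).trans_lt hN)) hval
  · rw [hend] at hmax
    have hsup : univ.sup κ ≤ N := Finset.sup_le fun j _ => hκ j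
    have hlt : 2 * univ.sup κ + 1 < 2 ^ (2 * N + 2) :=
      lt_of_le_of_lt (by omega) Nat.lt_two_pow_self
    simpa [Term.val, hmax] using fun _ => hlt
  · rw [hend] at hmax
    simp [Term.val, hmax]

/-- The greedy construction has reached a state after `r` steps which the store `s` holds. -/
def Reached (S : Matrix (Fin N) (Fin N) ℤˣ) (r : ℕ) (s : Store) : Prop :=
  ∃ R κ, GreedyState S R κ ∧ #R + r = N ∧ Encodes S R κ s

theorem Reached.wp_roundProg {r : ℕ} (h : Reached S r s) (hr : r < N - 1) :
    Wp (2 * N + 2) N roundProg (Reached S (r + 1)) s := by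
  obtain ⟨R, κ, hgreedy, hcard, hs⟩ := h
  have hκ (j : Fin N) : κ j + #R ≤ N := by simpa using hgreedy.add_card_le j
  refine (hs.wp_roundProg (fun j => by have := hκ j; omega) (by omega)).mono
    fun s' _ ⟨i, k, hik, hs'⟩ => ⟨R.erase k, _, hgreedy.step hik, ?_, hs'⟩
  have := card_erase_add_one hik.right_mem
  omega

theorem exists_outputs_signRankProg (hN : 2 ≤ N) (S : Matrix (Fin N) (Fin N) ℤˣ) :
    ∃ t R κ, GreedyState S R κ ∧ #R = 1 ∧ t ≤ signRankProg.timeBound (2 * N + 2) N ∧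
      Outputs signRankProg S t (2 * univ.sup κ + 1) := by
  suffices h : Wp (2 * N + 2) N signRankProg (fun s' => ∃ R κ, GreedyState S R κ ∧ #R = 1 ∧
      s'.reg 0 = 2 * univ.sup κ + 1) (input S) by
    obtain ⟨t, s', hex, ht, -, R, κ, hgreedy, hR, hout⟩ := h (input_bdd S)
    exact ⟨t, R, κ, hgreedy, hR, ht, s', hex, hout⟩
  have hs : Encodes S univ (fun _ => 0) ((input S).setReg Reg.rounds (N - 1)) :=
    (encodes_input S).setReg (by decide) _
  have hN' := lt_two_pow_two_mul_add_two N
  refine .seq (.assign (fun _ => (Nat.sub_le N 1).trans_lt hN') (.seq ?_))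
  refine Wp.mono (Wp.forLoop (I := Reached S) (by decide) (by decide) (by decide)
    (Nat.sub_le N 1) hN' ?_ fun r s hr _ _ h => ?_) ?_
  · exact ⟨univ, _, .start, by simp, hs.setReg (by decide) 0⟩
  · refine (h.wp_roundProg hr).mono fun s' _ ⟨R, κ, hgreedy, hcard, hs'⟩ => ?_
    exact ⟨R, κ, hgreedy, hcard, hs'.setReg (by decide) _⟩
  · rintro s' - ⟨R, κ, hgreedy, hcard, hs'⟩
    have hR : #R = 1 := by
      change #R + (N - 1) = N at hcard
      omega
    have hκ (j : Fin N) : κ j + #R ≤ N := by simpa using hgreedy.add_card_le j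
    exact (hs'.wp_outputProg fun j => by have := hκ j; omega).mono
      fun s'' _ hout => ⟨R, κ, hgreedy, hR, hout⟩

end Correctness

end RAM

theorem theorem8 :
    ∃ (c : ℝ) (p : RAM.Prog) (P : Polynomial ℕ), 0 < c ∧
      ∀ (N : ℕ), 2 ≤ N → ∀ S : Matrix (Fin N) (Fin N) ℤˣ,
        ∃ t A : ℕ, RAM.Outputs p S t A ∧ t ≤ P.eval N ∧
          signRank S ≤ A ∧ (A : ℝ) ≤ c * ((N : ℝ) / Real.log N) * (signRank S : ℝ) := by
  refine ⟨80, RAM.signRankProg, RAM.signRankProg.timeBound (2 * X + 2) X, by norm_num,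
    fun N hN S => ?_⟩
  obtain ⟨t, R, κ, hgreedy, hR, ht, hout⟩ := RAM.exists_outputs_signRankProg hN S
  have hbits : (2 * X + 2 : ℕ[X]).eval N = 2 * N + 2 := by
    rw [eval_add, eval_mul, eval_ofNat, eval_X]
  have htime := RAM.Prog.map_timeBound (evalRingHom N) (2 * X + 2) X RAM.signRankProg
  rw [coe_evalRingHom, hbits, eval_X] at htime
  exact ⟨t, 2 * univ.sup κ + 1, hout, ht.trans_eq htime.symm, hgreedy.signRank_le hR,
    hgreedy.two_mul_sup_add_one_le hN hR⟩
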